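/- For $i=1,2$ let $(X_i,\rho_i,\mu_i)$ be a space of homogeneous type in the sense of Coifman and Weiss: $\rho_i$ is a quasi-metric (a metric except that the triangle inequality is weakened to $\rho_i(x,y)\le A_0^{(i)}(\rho_i(x,z)+\rho_i(z,y))$ for some constant $A_0^{(i)}\ge 1$), $X_i$ carries the topology in which a set is open if it contains a ball $B(x,r)=\{y:\rho_i(x,y)<r\}$ around each of its points $x$, and $\mu_i$ is a nonzero Borel measure with $\mu_i(B(x,2r))\le C_{\mu_i}\,\mu_i(B(x,r))<\infty$ for all $x\in X_i$, $r>0$. Let $\mathcal D_i=\{Q^k_\alpha : k\in\mathbb Z,\ \alpha\in\mathscr A_k\}$ be a system of dyadic cubes on $X_i$ with parameters $\delta\in(0,1)$ and $0<c_1\le C_1<\infty$ (depending on $i$), that is, a countable family of Borel sets with centres $x^k_\alpha$ such that: - for each $k$, $X_i$ is the disjoint union of the cubes $Q^k_\alpha$ of generation $k$; - if $\ell\ge k$, then $Q^\ell_\beta\subseteq Q^k_\alpha$ or $Q^\ell_\beta\cap Q^k_\alpha=\emptyset$; - for each $(k,\alpha)$ and each $\ell\le k$ there is a unique $\beta$ with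 $Q^k_\alpha\subseteq Q^\ell_\beta$; - each $Q^k_\alpha$ contains at least $1$ and at most $M$ cubes of generation $k+1$ (its children), where $M$ does not depend on $(k,\alpha)$, and is their union; - $B(x^k_\alpha,c_1\delta^k)\subseteq Q^k_\alpha\subseteq B(x^k_\alpha,C_1\delta^k)$; - if $\ell\ge k$ and $Q^\ell_\beta\subseteq Q^k_\alpha$, then $B(x^\ell_\beta,C_1\delta^\ell)\subseteq B(x^k_\alpha,C_1\delta^k)$. Let $M_Q$ denote the number of children of a cube $Q$, put $\widetilde\chi_Q:=\mu_i(Q)^{-1/2}\chi_Q$ for $Q\in\mathcal D_i$, and let $\mu=\mu_1\times\mu_2$. Consider sequences $s=\{s_{Q_1,u_1,Q_2,u_2}\}$ of complex numbers indexed by $Q_i\in\mathcal D_i$ and $u_i=1,\dots,M_{Q_i}-1$, $i=1,2$. Let $s^1$ be the space of those sequences $s$ with $$\|s\|_{s^1}:=\Big\|\Big\{\sum_{Q_1,u_1,Q_2,u_2}\big|s_{Q_1,u_1,Q_2,u_2}\,\widetilde\chi_{Q_1}(x_1)\,\widetilde\chi_{Q_2}(x_2)\big|^2\Big\}^{1/2}\Big\|_{L^1(X_1\times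 X_2)}<\infty ,$$ and let $c^1$ be the space of those sequences $t$ with $$\|t\|_{c^1}:=\sup_\Omega\Big(\frac1{\mu(\Omega)}\sum_{Q_1\times Q_2\subseteq\Omega}\ \sum_{u_1=1}^{M_{Q_1}-1}\sum_{u_2=1}^{M_{Q_2}-1}|t_{Q_1,u_1,Q_2,u_2}|^2\Big)^{1/2}<\infty ,$$ where the supremum is over the nonempty open sets $\Omega\subseteq X_1\times X_2$ of finite measure. **Theorem.** $(s^1)'=c^1$. Precisely: there is a constant $C$ such that for every $t\in c^1$ and every $s\in s^1$ the series $$L_t(s):=\sum_{Q_1,u_1,Q_2,u_2}s_{Q_1,u_1,Q_2,u_2}\,\overline{t_{Q_1,u_1,Q_2,u_2}}$$ converges absolutely and $|L_t(s)|\le C\,\|s\|_{s^1}\|t\|_{c^1}$. The map $t\mapsto L_t$ is a conjugate-linear bijection of $c^1$ onto the space $(s^1)'$ of bounded linear functionals on $s^1$, and $\|t\|_{c^1}\le\|L_t\|_{(s^1)'}$ for every $t\in c^1$. -/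

import Mathlib

open MeasureTheory Set
open scoped ENNReal NNReal

namespace ProductHaar

noncomputable section

/-- The ball `B(x, r) = {y : ρ x y < r}` of a quasi-metric `ρ`. -/
def qball {X : Type*} (ρ : X → X → ℝ) (x : X) (r : ℝ) : Set X := {y | ρ x y < r}

/-- `ρ` is a quasi-metric on `X`, and the topology of `X` is the one induced by `ρ`: a set is open
if and only if it contains a ball around each of its points. (Balls themselves need not be open.) -/
structure IsQuasiMetric {X : Type*} [TopologicalSpace X] (ρ : X → X → ℝ) : Prop where
  nonneg : ∀ x y, 0 ≤ ρ x y
  symm : ∀ x y, ρ x y = ρ y x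
  eq_zero_iff : ∀ x y, ρ x y = 0 ↔ x = y
  quasi_triangle : ∃ A₀ : ℝ, 1 ≤ A₀ ∧ ∀ x y z, ρ x y ≤ A₀ * (ρ x z + ρ z y)
  isOpen_iff : ∀ s : Set X, IsOpen s ↔ ∀ x ∈ s, ∃ ε > 0, qball ρ x ε ⊆ s

/-- `(X, ρ, μ)` is a space of homogeneous type in the sense of Coifman and Weiss: `ρ` is a
quasi-metric and `μ` is a nonzero doubling Borel measure. -/
structure IsHomogeneousType {X : Type*} [TopologicalSpace X] [MeasurableSpace X]
    (ρ : X → X → ℝ) (μ : Measure X) : Prop where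
  isQuasiMetric : IsQuasiMetric ρ
  borelSpace : BorelSpace X
  measure_ne_zero : μ ≠ 0
  doubling : ∃ C : ℝ≥0, ∀ (x : X) (r : ℝ), 0 < r →
    μ (qball ρ x (2 * r)) ≤ C * μ (qball ρ x r) ∧ μ (qball ρ x r) < ∞

/-- A system of dyadic cubes `Q^k_α` (`k : ℤ`, `α : ι k`) on a quasi-metric space, with centres
`x^k_α` and parameters `δ ∈ (0, 1)`, `0 < c₁ ≤ C₁ < ∞`. -/
structure DyadicSystem {X : Type*} [MeasurableSpace X] (ρ : X → X → ℝ) where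
  δ : ℝ
  δ_pos : 0 < δ
  δ_lt_one : δ < 1
  c₁ : ℝ
  C₁ : ℝ
  c₁_pos : 0 < c₁
  c₁_le_C₁ : c₁ ≤ C₁
  ι : ℤ → Type
  countable_ι : ∀ k, Countable (ι k)
  cube : ∀ k, ι k → Set X
  center : ∀ k, ι k → X
  measurableSet_cube : ∀ k α, MeasurableSet (cube k α)
  iUnion_cube : ∀ k, ⋃ α, cube k α = univ
  disjoint_cube : ∀ k α β, α ≠ β → Disjoint (cube k α) (cube k β)
  nested : ∀ k l, k ≤ l → ∀ (α : ι k) (β : ι l),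
    cube l β ⊆ cube k α ∨ Disjoint (cube k α) (cube l β)
  ancestor : ∀ k l, l ≤ k → ∀ α : ι k, ∃! β : ι l, cube k α ⊆ cube l β
  children : ∃ M : ℕ, ∀ k (α : ι k),
    {β : ι (k + 1) | cube (k + 1) β ⊆ cube k α}.Finite ∧
    1 ≤ {β : ι (k + 1) | cube (k + 1) β ⊆ cube k α}.ncard ∧
    {β : ι (k + 1) | cube (k + 1) β ⊆ cube k α}.ncard ≤ M ∧
    cube k α = ⋃ β ∈ {β : ι (k + 1) | cube (k + 1) β ⊆ cube k α}, cube (k + 1) β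
  ball_subset : ∀ k α, qball ρ (center k α) (c₁ * δ ^ k) ⊆ cube k α
  subset_ball : ∀ k α, cube k α ⊆ qball ρ (center k α) (C₁ * δ ^ k)
  ball_mono : ∀ k l, k ≤ l → ∀ (α : ι k) (β : ι l), cube l β ⊆ cube k α →
    qball ρ (center l β) (C₁ * δ ^ l) ⊆ qball ρ (center k α) (C₁ * δ ^ k)

section OneParameter

variable {X : Type*} [MeasurableSpace X] {ρ : X → X → ℝ}

/-- The number `M_Q` of dyadic children of the cube `Q = Q^k_α`. -/
def DyadicSystem.numChildren (D : DyadicSystem ρ) (k : ℤ) (α : D.ι k) : ℕ :=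
  {β : D.ι (k + 1) | D.cube (k + 1) β ⊆ D.cube k α}.ncard

/-- The indices `(Q, u)`, `u = 1, …, M_Q - 1`, of the cancellative Haar functions. A set that is a
cube of several generations has more than one child in at most one of them, so that indexing by
`(k, α)` repeats no pair `(Q, u)`. -/
abbrev HaarIndex (D : DyadicSystem ρ) : Type :=
  Σ (k : ℤ) (α : D.ι k), Fin (D.numChildren k α - 1)

/-- The cube `Q` of a Haar index `(Q, u)`. -/
def HaarIndex.cube {D : DyadicSystem ρ} (i : HaarIndex D) : Set X := D.cube i.1 i.2.1

instance (D : DyadicSystem ρ) : Countable (HaarIndex D) :=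
  have := D.countable_ι
  inferInstance

/-- The `L²`-normalized indicator `μ(Q)^{-1/2} χ_Q`. -/
def normIndicator (μ : Measure X) (Q : Set X) (x : X) : ℝ≥0∞ :=
  Q.indicator (fun _ => μ Q ^ (-(1 / 2) : ℝ)) x

end OneParameter

section Minkowski

theorem tsum_sq_add_le {I : Type*} (a b : I → ℝ≥0∞) :
    (∑' i, (a i + b i) ^ 2) ^ (1 / 2 : ℝ) ≤
      (∑' i, a i ^ 2) ^ (1 / 2 : ℝ) + (∑' i, b i ^ 2) ^ (1 / 2 : ℝ) := by
  let _ : MeasurableSpace I := ⊤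
  have h := ENNReal.lintegral_Lp_add_le (μ := Measure.count) (f := a) (g := b) (p := 2)
    (measurable_from_top.aemeasurable) (measurable_from_top.aemeasurable) (by norm_num)
  simpa [lintegral_count] using h

theorem tsum_sq_smul {I : Type*} (c : ℝ≥0∞) (a : I → ℝ≥0∞) :
    (∑' i, (c * a i) ^ 2) ^ (1 / 2 : ℝ) = c * (∑' i, a i ^ 2) ^ (1 / 2 : ℝ) := by
  simp_rw [mul_pow]
  rw [ENNReal.tsum_mul_left, ENNReal.mul_rpow_of_nonneg _ _ (by norm_num)]
  congr 1
  rw [← ENNReal.rpow_natCast, ← ENNReal.rpow_mul]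
  norm_num

theorem sqrt_tsum_sq_mono {I : Type*} {a b : I → ℝ≥0∞} (h : ∀ i, a i ≤ b i) :
    (∑' i, a i ^ 2) ^ (1 / 2 : ℝ) ≤ (∑' i, b i ^ 2) ^ (1 / 2 : ℝ) :=
  ENNReal.rpow_le_rpow (ENNReal.tsum_le_tsum fun i => pow_le_pow_left' (h i) 2) (by norm_num)

end Minkowski

section Spaces

variable {X₁ X₂ : Type*} [MeasurableSpace X₁] [MeasurableSpace X₂]
  {ρ₁ : X₁ → X₁ → ℝ} {ρ₂ : X₂ → X₂ → ℝ}
  (μ₁ : Measure X₁) (μ₂ : Measure X₂) (D₁ : DyadicSystem ρ₁) (D₂ : DyadicSystem ρ₂)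

/-- Sequences `s = {s_{Q₁,u₁,Q₂,u₂}}` of complex numbers. -/
abbrev HaarSeq : Type := HaarIndex D₁ × HaarIndex D₂ → ℂ

variable {D₁ D₂} in
/-- The square function `{∑ |s_{Q₁,u₁,Q₂,u₂} χ̃_{Q₁}(x₁) χ̃_{Q₂}(x₂)|²}^{1/2}`. -/
def squareFunction (s : HaarSeq D₁ D₂) (x : X₁ × X₂) : ℝ≥0∞ :=
  (∑' i : HaarIndex D₁ × HaarIndex D₂,
    (‖s i‖ₑ * (normIndicator μ₁ i.1.cube x.1 * normIndicator μ₂ i.2.cube x.2)) ^ 2) ^ (1 / 2 : ℝ)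

variable {D₁ D₂} in
/-- The `s¹` norm: the `L¹(X₁ × X₂)` norm of the square function, possibly infinite. -/
def s1Norm (s : HaarSeq D₁ D₂) : ℝ≥0∞ :=
  ∫⁻ x, squareFunction μ₁ μ₂ s x ∂(μ₁.prod μ₂)

variable {D₁ D₂} in
/-- The Carleson quotient
`(μ(Ω)⁻¹ ∑_{Q₁ × Q₂ ⊆ Ω} ∑_{u₁,u₂} |t_{Q₁,u₁,Q₂,u₂}|²)^{1/2}` of a set `Ω ⊆ X₁ × X₂`. -/
def carleson (t : HaarSeq D₁ D₂) (Ω : Set (X₁ × X₂)) : ℝ≥0∞ :=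
  ((μ₁.prod μ₂ Ω)⁻¹ *
    ∑' i : {i : HaarIndex D₁ × HaarIndex D₂ // i.1.cube ×ˢ i.2.cube ⊆ Ω}, ‖t i‖ₑ ^ 2) ^ (1 / 2 : ℝ)

variable {D₁ D₂} in
/-- The `c¹` norm: the supremum of the Carleson quotients over the open sets of finite measure,
possibly infinite. -/
def c1Norm [TopologicalSpace X₁] [TopologicalSpace X₂] (t : HaarSeq D₁ D₂) : ℝ≥0∞ :=
  ⨆ (Ω : Set (X₁ × X₂)) (_ : IsOpen Ω) (_ : μ₁.prod μ₂ Ω < ∞), carleson μ₁ μ₂ t Ω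

variable {D₁ D₂}

theorem measurable_normIndicator {X : Type*} [MeasurableSpace X] {ρ : X → X → ℝ}
    {D : DyadicSystem ρ} (μ : Measure X) (i : HaarIndex D) :
    Measurable (normIndicator μ i.cube) :=
  measurable_const.indicator (D.measurableSet_cube _ _)

theorem measurable_squareFunction (s : HaarSeq D₁ D₂) :
    Measurable (squareFunction μ₁ μ₂ s) := by
  refine Measurable.pow_const (Measurable.tsum fun i => ?_) _
  exact ((((measurable_normIndicator μ₁ i.1).comp measurable_fst).mul
    ((measurable_normIndicator μ₂ i.2).comp measurable_snd)).const_mul _).pow_const 2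

theorem squareFunction_add_le (s s' : HaarSeq D₁ D₂) (x : X₁ × X₂) :
    squareFunction μ₁ μ₂ (s + s') x ≤ squareFunction μ₁ μ₂ s x + squareFunction μ₁ μ₂ s' x := by
  refine le_trans (sqrt_tsum_sq_mono fun i => ?_) (tsum_sq_add_le _ _)
  rw [← add_mul]
  gcongr
  exact enorm_add_le _ _

theorem s1Norm_add_le (s s' : HaarSeq D₁ D₂) :
    s1Norm μ₁ μ₂ (s + s') ≤ s1Norm μ₁ μ₂ s + s1Norm μ₁ μ₂ s' := by
  unfold s1Norm
  rw [← lintegral_add_left (measurable_squareFunction μ₁ μ₂ s)]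
  exact lintegral_mono fun x => squareFunction_add_le μ₁ μ₂ s s' x

theorem s1Norm_smul (c : ℂ) (s : HaarSeq D₁ D₂) :
    s1Norm μ₁ μ₂ (c • s) = ‖c‖ₑ * s1Norm μ₁ μ₂ s := by
  unfold s1Norm
  rw [← lintegral_const_mul _ (measurable_squareFunction μ₁ μ₂ s)]
  refine lintegral_congr fun x => ?_
  unfold squareFunction
  rw [← tsum_sq_smul]
  simp [mul_assoc]

theorem carleson_add_le (t t' : HaarSeq D₁ D₂) (Ω : Set (X₁ × X₂)) :
    carleson μ₁ μ₂ (t + t') Ω ≤ carleson μ₁ μ₂ t Ω + carleson μ₁ μ₂ t' Ω := by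
  unfold carleson
  simp_rw [ENNReal.mul_rpow_of_nonneg _ _ (by norm_num : (0 : ℝ) ≤ 1 / 2)]
  rw [← mul_add]
  gcongr
  exact le_trans (sqrt_tsum_sq_mono fun i => enorm_add_le _ _) (tsum_sq_add_le _ _)

theorem carleson_smul (c : ℂ) (t : HaarSeq D₁ D₂) (Ω : Set (X₁ × X₂)) :
    carleson μ₁ μ₂ (c • t) Ω = ‖c‖ₑ * carleson μ₁ μ₂ t Ω := by
  unfold carleson
  simp_rw [ENNReal.mul_rpow_of_nonneg _ _ (by norm_num : (0 : ℝ) ≤ 1 / 2)]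
  rw [mul_left_comm]
  congr 1
  rw [← tsum_sq_smul]
  simp

variable (D₁ D₂)

/-- The sequence space `s¹`. -/
def s1Submodule : Submodule ℂ (HaarSeq D₁ D₂) where
  carrier := {s | s1Norm μ₁ μ₂ s < ∞}
  zero_mem' := by
    have h := s1Norm_smul μ₁ μ₂ 0 (0 : HaarSeq D₁ D₂)
    simp only [smul_zero, enorm_zero, zero_mul] at h
    simp [h]
  add_mem' {s s'} hs hs' := (s1Norm_add_le μ₁ μ₂ s s').trans_lt (ENNReal.add_lt_top.2 ⟨hs, hs'⟩)
  smul_mem' c s hs := by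
    simp only [mem_ofPred_eq, s1Norm_smul] at hs ⊢
    exact ENNReal.mul_lt_top enorm_lt_top hs

/-- The space `s¹` as a type of its own, so that its topology is that of the `s¹` norm and not the
one inherited from the space of all sequences. -/
def S1 : Type := s1Submodule μ₁ μ₂ D₁ D₂

instance : AddCommGroup (S1 μ₁ μ₂ D₁ D₂) :=
  inferInstanceAs (AddCommGroup (s1Submodule μ₁ μ₂ D₁ D₂))

instance : Module ℂ (S1 μ₁ μ₂ D₁ D₂) :=
  inferInstanceAs (Module ℂ (s1Submodule μ₁ μ₂ D₁ D₂))

instance : CoeFun (S1 μ₁ μ₂ D₁ D₂) (fun _ => HaarIndex D₁ × HaarIndex D₂ → ℂ) :=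
  ⟨fun s => s.1⟩

instance : Norm (S1 μ₁ μ₂ D₁ D₂) := ⟨fun s => (s1Norm μ₁ μ₂ s.1).toReal⟩

theorem S1.core : SeminormedSpace.Core ℂ (S1 μ₁ μ₂ D₁ D₂) where
  norm_nonneg _ := ENNReal.toReal_nonneg
  norm_smul c s := by
    change (s1Norm μ₁ μ₂ (c • s.1)).toReal = _ * (s1Norm μ₁ μ₂ s.1).toReal
    rw [s1Norm_smul, ENNReal.toReal_mul, toReal_enorm]
  norm_triangle s s' := by
    change (s1Norm μ₁ μ₂ (s.1 + s'.1)).toReal ≤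
      (s1Norm μ₁ μ₂ s.1).toReal + (s1Norm μ₁ μ₂ s'.1).toReal
    rw [← ENNReal.toReal_add (ne_of_lt s.2) (ne_of_lt s'.2)]
    exact ENNReal.toReal_mono (ENNReal.add_ne_top.2 ⟨ne_of_lt s.2, ne_of_lt s'.2⟩)
      (s1Norm_add_le μ₁ μ₂ s.1 s'.1)

/-- Only the seminorm axioms are recorded; they suffice to form the dual space. -/
instance : SeminormedAddCommGroup (S1 μ₁ μ₂ D₁ D₂) :=
  SeminormedAddCommGroup.ofCore (S1.core μ₁ μ₂ D₁ D₂)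

instance : NormedSpace ℂ (S1 μ₁ μ₂ D₁ D₂) where
  norm_smul_le c s := ((S1.core μ₁ μ₂ D₁ D₂).norm_smul c s).le

variable [TopologicalSpace X₁] [TopologicalSpace X₂]

/-- The sequence space `c¹`. -/
def c1Submodule : Submodule ℂ (HaarSeq D₁ D₂) where
  carrier := {t | c1Norm μ₁ μ₂ t < ∞}
  zero_mem' := by simp [c1Norm, carleson]
  add_mem' {t t'} ht ht' := by
    refine lt_of_le_of_lt ?_ (ENNReal.add_lt_top.2 ⟨ht, ht'⟩)
    refine iSup_le fun Ω => iSup_le fun hΩ => iSup_le fun hf => ?_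
    exact (carleson_add_le μ₁ μ₂ t t' Ω).trans (add_le_add
      (le_iSup_of_le Ω (le_iSup_of_le hΩ (le_iSup_of_le hf le_rfl)))
      (le_iSup_of_le Ω (le_iSup_of_le hΩ (le_iSup_of_le hf le_rfl))))
  smul_mem' c t ht := by
    simp only [mem_ofPred_eq, c1Norm, carleson_smul, ← ENNReal.mul_iSup] at ht ⊢
    exact ENNReal.mul_lt_top enorm_lt_top ht

/-- The space `c¹` as a type of its own, normed by the `c¹` norm. -/
def C1 : Type := c1Submodule μ₁ μ₂ D₁ D₂

instance : AddCommGroup (C1 μ₁ μ₂ D₁ D₂) :=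
  inferInstanceAs (AddCommGroup (c1Submodule μ₁ μ₂ D₁ D₂))

instance : Module ℂ (C1 μ₁ μ₂ D₁ D₂) :=
  inferInstanceAs (Module ℂ (c1Submodule μ₁ μ₂ D₁ D₂))

instance : CoeFun (C1 μ₁ μ₂ D₁ D₂) (fun _ => HaarIndex D₁ × HaarIndex D₂ → ℂ) :=
  ⟨fun t => t.1⟩

instance : Norm (C1 μ₁ μ₂ D₁ D₂) := ⟨fun t => (c1Norm μ₁ μ₂ t.1).toReal⟩

end Spaces

end

end ProductHaar

open ProductHaar

/-!
The lower bound `‖t‖ ≤ ‖L_t‖` and the surjectivity of `t ↦ L_t` rest on one test. If `s` is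
supported on rectangles contained in `Ω`, then its square function lives on `Ω`, and the Cauchy–Schwarz
inequality gives `‖s‖ ≤ μ(Ω)^{1/2} (∑ |s_R|²)^{1/2}` (`s1Norm_le_of_support`). Testing a functional
`L` on the finite truncations of its own coefficients therefore bounds their Carleson quotients by
`‖L‖` (`carleson_conj_apply_single_le`), and `L` is determined by its coefficients because finite
sequences are dense in `s¹` (`S1.hasSum_smul_single`).

The upper bound is `tsum_mul_le_of_carleson`. For each rectangle `R` with `s_R ≠ 0` one takes, up to
a factor `2`, the median `l_R` of the square function `S` of `s` on `R`, and writes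
`∑ |s_R| |t_R| ≤ (∑ |s_R|² / l_R)^{1/2} (∑ l_R |t_R|²)^{1/2}`.
* On at least half of `R` one has `S ≤ 2 l_R`, so `|s_R|² / l_R ≤ 4 ∫ |s_R|² (χ_R / μ(R)) / S`. The
  sum over `R` is at most `4 ∫ S² / S`.
* Since `l_R = ∫_0^∞ χ_{λ < l_R} dλ`, and since `λ < l_R` forces more than half of `R` to lie in
  `Ω_λ = {S > λ}`, the second sum is at most `∫_0^∞ ∑_{R ⊆ U_λ} |t_R|² dλ`, where `U_λ` is the union
  of the rectangles more than half of which lies in `Ω_λ`. The Carleson condition bounds the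
  integrand by `‖t‖² μ(U_λ)`, and `μ(U_λ) ≤ 16 μ(Ω_λ)`, so that the whole is at most `16 ‖t‖² ∫ S`.

The inequality `μ(U_λ) ≤ 16 μ(Ω_λ)` (`measure_iUnion_prod_le`) replaces the `L²` bound of the strong
maximal function: for indicators of sets, the elementary weak type inequality for nested families in
one variable can be applied in each variable in turn.

The Carleson condition is imposed on open sets only, whereas `U_λ` need not be open. The
quasi-metric topology is induced by a countably generated uniformity and is second countable, so the product
measure is outer regular, and the condition extends to all sets of finite measure
(`tsum_sq_le_c1Norm`).
-/

namespace ProductHaar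

open Filter Topology

/-! ### Topology and measure on a space of homogeneous type -/

section Homogeneous

variable {X : Type*} [TopologicalSpace X] {ρ : X → X → ℝ}

/-- The uniformity of a quasi-metric, generated by the entourages `{(x, y) | ρ x y < ε}`. Its
topology is the given one. -/
@[reducible]
def IsQuasiMetric.uniformSpace (h : IsQuasiMetric ρ) : UniformSpace X :=
  UniformSpace.ofCoreEq
    { uniformity := comap (fun p : X × X => ρ p.1 p.2) (𝓝 0)
      refl := by
        refine ((Metric.nhds_basis_ball (x := (0 : ℝ))).comap _).ge_iff.2 fun ε hε => ?_
        rintro ⟨x, y⟩ (rfl : x = y)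
        simpa [(h.eq_zero_iff x x).2 rfl] using hε
      symm := by
        rw [tendsto_comap_iff]
        have : (fun p : X × X => ρ p.1 p.2) ∘ Prod.swap = fun p => ρ p.1 p.2 := by
          ext p
          exact h.symm _ _
        rw [this]
        exact tendsto_comap
      comp := by
        obtain ⟨A, hA, htri⟩ := h.quasi_triangle
        refine ((Metric.nhds_basis_ball (x := (0 : ℝ))).comap _).ge_iff.2 fun ε hε => ?_
        have hm : (fun p : X × X => ρ p.1 p.2) ⁻¹' Metric.ball 0 (ε / (2 * A)) ∈
            comap (fun p : X × X => ρ p.1 p.2) (𝓝 0) :=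
          preimage_mem_comap (Metric.ball_mem_nhds _ (by positivity))
        refine mem_of_superset (mem_lift' hm) ?_
        rintro ⟨x, y⟩ ⟨z, hxz, hzy⟩
        simp only [mem_preimage, Metric.mem_ball, dist_zero_right, Real.norm_eq_abs,
          abs_of_nonneg (h.nonneg _ _)] at hxz hzy ⊢
        calc ρ x y ≤ A * (ρ x z + ρ z y) := htri x y z
          _ < A * (ε / (2 * A) + ε / (2 * A)) := by gcongr
          _ = ε := by field_simp; norm_num }
    _ (by
      ext s
      rw [h.isOpen_iff]
      refine forall₂_congr fun x _ => ?_
      change _ ↔ s ∈ comap (Prod.mk x) (comap (fun p : X × X => ρ p.1 p.2) (𝓝 0))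
      rw [comap_comap, ((Metric.nhds_basis_ball (x := (0 : ℝ))).comap _).mem_iff]
      refine exists_congr fun ε => and_congr_right fun _ => ?_
      have : qball ρ x ε =
          ((fun p : X × X => ρ p.1 p.2) ∘ Prod.mk x) ⁻¹' Metric.ball 0 ε := by
        ext y
        simp [qball, abs_of_nonneg (h.nonneg _ _)]
      rw [this])

theorem IsQuasiMetric.isCountablyGenerated (h : IsQuasiMetric ρ) :
    (@uniformity X h.uniformSpace).IsCountablyGenerated :=
  inferInstanceAs (comap (fun p : X × X => ρ p.1 p.2) (𝓝 0)).IsCountablyGenerated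

theorem IsQuasiMetric.pseudoMetrizableSpace (h : IsQuasiMetric ρ) :
    TopologicalSpace.PseudoMetrizableSpace X := by
  let := h.uniformSpace
  have := h.isCountablyGenerated
  infer_instance

theorem IsQuasiMetric.qball_mem_nhds (h : IsQuasiMetric ρ) (x : X) {r : ℝ} (hr : 0 < r) :
    qball ρ x r ∈ 𝓝 x := by
  let := h.uniformSpace
  rw [nhds_eq_comap_uniformity]
  change _ ∈ comap (Prod.mk x) (comap (fun p : X × X => ρ p.1 p.2) (𝓝 0))
  rw [comap_comap]
  exact preimage_mem_comap (Iio_mem_nhds hr)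

variable [MeasurableSpace X]

/-- The centres of the cubes form a countable dense set. -/
theorem IsQuasiMetric.secondCountableTopology (h : IsQuasiMetric ρ) (D : DyadicSystem ρ) :
    SecondCountableTopology X := by
  let := h.uniformSpace
  have := h.isCountablyGenerated
  have := D.countable_ι
  have : TopologicalSpace.SeparableSpace X := by
    refine ⟨⟨range fun i : Σ k, D.ι k => D.center i.1 i.2, countable_range _, fun x => ?_⟩⟩
    rw [mem_closure_iff]
    intro o ho hx
    obtain ⟨ε, hε, hεo⟩ := (h.isOpen_iff o).1 ho x hx
    have hC : 0 < D.C₁ := D.c₁_pos.trans_le D.c₁_le_C₁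
    obtain ⟨n, hn⟩ := exists_pow_lt_of_lt_one (div_pos hε hC) D.δ_lt_one
    obtain ⟨α, hα⟩ := mem_iUnion.1 ((D.iUnion_cube (n : ℤ)).symm ▸ mem_univ x)
    refine ⟨D.center n α, hεo ?_, ⟨⟨n, α⟩, rfl⟩⟩
    have hx' : ρ (D.center n α) x < D.C₁ * D.δ ^ (n : ℤ) := D.subset_ball _ _ hα
    rw [zpow_natCast] at hx'
    change ρ x _ < ε
    rw [h.symm]
    exact hx'.trans ((lt_div_iff₀' hC).1 hn)
  exact UniformSpace.secondCountable_of_separable X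

variable {μ : Measure X}

theorem IsHomogeneousType.isLocallyFiniteMeasure (h : IsHomogeneousType ρ μ) :
    IsLocallyFiniteMeasure μ := by
  obtain ⟨C, hC⟩ := h.doubling
  exact ⟨fun x => ⟨_, h.isQuasiMetric.qball_mem_nhds x one_pos, (hC x 1 one_pos).2⟩⟩

/-- If one ball were null, then by doubling all its dilates, and hence `X`, would be. -/
theorem IsHomogeneousType.measure_qball_pos (h : IsHomogeneousType ρ μ) (x : X) {r : ℝ}
    (hr : 0 < r) : 0 < μ (qball ρ x r) := by
  obtain ⟨C, hC⟩ := h.doubling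
  refine pos_iff_ne_zero.2 fun h0 => h.measure_ne_zero ?_
  have hn : ∀ n : ℕ, μ (qball ρ x (2 ^ n * r)) = 0 := by
    intro n
    induction n with
    | zero => simpa using h0
    | succ n ih =>
      have := (hC x (2 ^ n * r) (by positivity)).1
      rw [ih, mul_zero, nonpos_iff_eq_zero] at this
      rwa [pow_succ', mul_assoc]
  have hU : (⋃ n : ℕ, qball ρ x (2 ^ n * r)) = univ := by
    refine eq_univ_of_forall fun y => mem_iUnion.2 ?_
    obtain ⟨n, hn⟩ := pow_unbounded_of_one_lt (ρ x y / r) one_lt_two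
    exact ⟨n, (div_lt_iff₀ hr).1 hn⟩
  rw [← Measure.measure_univ_eq_zero, ← hU]
  exact measure_iUnion_null hn

theorem IsHomogeneousType.measure_cube_pos (h : IsHomogeneousType ρ μ) (D : DyadicSystem ρ)
    (k : ℤ) (α : D.ι k) : 0 < μ (D.cube k α) :=
  (h.measure_qball_pos _ (mul_pos D.c₁_pos (zpow_pos D.δ_pos k))).trans_le
    (measure_mono (D.ball_subset k α))

theorem IsHomogeneousType.measure_cube_lt_top (h : IsHomogeneousType ρ μ) (D : DyadicSystem ρ)
    (k : ℤ) (α : D.ι k) : μ (D.cube k α) < ∞ := by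
  obtain ⟨C, hC⟩ := h.doubling
  exact (measure_mono (D.subset_ball k α)).trans_lt
    (hC _ _ (mul_pos (D.c₁_pos.trans_le D.c₁_le_C₁) (zpow_pos D.δ_pos k))).2

end Homogeneous

/-! ### Dyadic maximal inequalities for sets -/

section Maximal

/-- A family of sets is laminar if any two of its members are nested or disjoint. -/
def IsLaminar {ι X : Type*} (Q : ι → Set X) : Prop :=
  ∀ i j, Q i ⊆ Q j ∨ Q j ⊆ Q i ∨ Disjoint (Q i) (Q j)

theorem isLaminar_cube {X : Type*} [MeasurableSpace X] {ρ : X → X → ℝ} (D : DyadicSystem ρ) :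
    IsLaminar (fun i : HaarIndex D => i.cube) := by
  intro i j
  rcases le_total i.1 j.1 with h | h
  · rcases D.nested _ _ h i.2.1 j.2.1 with h | h
    · exact .inr (.inl h)
    · exact .inr (.inr h)
  · rcases D.nested _ _ h j.2.1 i.2.1 with h | h
    · exact .inl h
    · exact .inr (.inr h.symm)

variable {ι ι₁ ι₂ X X₁ X₂ : Type*} [MeasurableSpace X] [MeasurableSpace X₁] [MeasurableSpace X₂]

/-- The weak type `(1, 1)` inequality of the dyadic maximal function for finitely many sets: the
maximal ones are disjoint and have the same union. -/
theorem IsLaminar.measure_finset_union_le_mul {Q : ι → Set X} (hQ : IsLaminar Q)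
    (hm : ∀ i, MeasurableSet (Q i)) (μ : Measure X) {E : Set X} (c : ℝ≥0∞) (F : Finset ι)
    (hF : ∀ i ∈ F, μ (Q i) ≤ c * μ (Q i ∩ E)) : μ (⋃ i ∈ F, Q i) ≤ c * μ E := by
  classical
  -- Distinct indices may carry the same set, so the maximal members are taken among the sets.
  set G : Finset (Set X) := F.image Q
  set M : Finset (Set X) := G.filter fun A => Maximal (· ∈ G) A
  have hMG : ∀ A ∈ M, ∃ i ∈ F, Q i = A := fun A hA =>
    Finset.mem_image.1 (Finset.mem_filter.1 hA).1
  have hMm : ∀ A ∈ M, MeasurableSet A := by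
    intro A hA
    obtain ⟨i, -, rfl⟩ := hMG A hA
    exact hm i
  have hdisj : PairwiseDisjoint (↑M) (id : Set X → Set X) := by
    intro A hA B hB hAB
    have hA' := (Finset.mem_filter.1 hA).2
    have hB' := (Finset.mem_filter.1 hB).2
    obtain ⟨i, hi, rfl⟩ := hMG A hA
    obtain ⟨j, hj, rfl⟩ := hMG B hB
    rcases hQ i j with h | h | h
    · exact absurd (hA'.eq_of_le hB'.prop h) hAB
    · exact absurd (hB'.eq_of_le hA'.prop h).symm hAB
    · exact h
  have hsub : (⋃ i ∈ F, Q i) ⊆ ⋃ A ∈ M, id A := by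
    refine iUnion₂_subset fun i hi => ?_
    obtain ⟨B, hB, hBmax⟩ := G.exists_le_maximal (Finset.mem_image_of_mem Q hi)
    exact hB.trans (subset_biUnion_of_mem (u := id)
      (Finset.mem_coe.2 (Finset.mem_filter.2 ⟨hBmax.prop, hBmax⟩)))
  calc μ (⋃ i ∈ F, Q i) ≤ μ (⋃ A ∈ M, id A) := measure_mono hsub
    _ ≤ ∑ A ∈ M, μ A := measure_biUnion_finset_le M id
    _ ≤ ∑ A ∈ M, c * μ (A ∩ E) := by
        refine Finset.sum_le_sum fun A hA => ?_
        obtain ⟨i, hi, rfl⟩ := hMG A hA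
        exact hF i hi
    _ = c * ∑ A ∈ M, μ.restrict E A := by
        rw [Finset.mul_sum]
        exact Finset.sum_congr rfl fun A hA => by rw [Measure.restrict_apply (hMm A hA)]
    _ = c * μ.restrict E (⋃ A ∈ M, id A) := by
        rw [measure_biUnion_finset hdisj hMm]
        rfl
    _ ≤ c * μ E := by
        refine mul_le_mul_right ?_ c
        exact (measure_mono (subset_univ _)).trans (Measure.restrict_apply_univ E).le

/-- The union of the members `Q` of a countable laminar family of relative density
`μ (Q ∩ E) / μ Q > c⁻¹` has measure at most `c * μ E`. -/
theorem IsLaminar.measure_union_dense_le [Countable ι] {Q : ι → Set X} (hQ : IsLaminar Q)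
    (hm : ∀ i, MeasurableSet (Q i)) (μ : Measure X) (E : Set X) (c : ℝ≥0∞) :
    μ (⋃ i ∈ {i | μ (Q i) < c * μ (Q i ∩ E)}, Q i) ≤ c * μ E := by
  classical
  rw [biUnion_eq_iUnion, iUnion_eq_iUnion_finset, Directed.measure_iUnion]
  swap
  · exact directed_of_isDirected_le fun s t hst => biUnion_subset_biUnion_left hst
  refine iSup_le fun F => ?_
  have hQ' : IsLaminar fun i : {i | μ (Q i) < c * μ (Q i ∩ E)} => Q i := fun i j => hQ i j
  exact hQ'.measure_finset_union_le_mul (fun i => hm i) μ c F fun i _ => i.2.out.le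

/-- The strong dyadic maximal inequality for sets: the union of the rectangles more than half of
whose measure lies in `Ω` has measure at most `16 * μ Ω`. The one-parameter inequality is applied
in the second variable with density `1 / 4` and then in the first one: if more than half of
`Q₁ × Q₂` lies in `Ω`, then for more than a quarter of the `x₁ ∈ Q₁` more than a quarter of
`{x₁} × Q₂` does. -/
theorem measure_iUnion_prod_le [Countable ι₁] [Countable ι₂] {Q₁ : ι₁ → Set X₁} {Q₂ : ι₂ → Set X₂}
    (h₁ : IsLaminar Q₁) (h₂ : IsLaminar Q₂) (hm₁ : ∀ i, MeasurableSet (Q₁ i))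
    (hm₂ : ∀ i, MeasurableSet (Q₂ i)) (μ₁ : Measure X₁) (μ₂ : Measure X₂) [SFinite μ₁] [SFinite μ₂]
    (hf₁ : ∀ i, μ₁ (Q₁ i) ≠ ∞) (hp₂ : ∀ i, μ₂ (Q₂ i) ≠ 0)
    (hf₂ : ∀ i, μ₂ (Q₂ i) ≠ ∞) {Ω : Set (X₁ × X₂)} (hΩ : MeasurableSet Ω) :
    μ₁.prod μ₂ (⋃ i ∈ {i : ι₁ × ι₂ | μ₁.prod μ₂ (Q₁ i.1 ×ˢ Q₂ i.2) <
      2 * μ₁.prod μ₂ ((Q₁ i.1 ×ˢ Q₂ i.2) ∩ Ω)}, Q₁ i.1 ×ˢ Q₂ i.2) ≤ 16 * μ₁.prod μ₂ Ω := by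
  -- `Ω'` gathers the sets `{x} ×ˢ Q₂ j` more than a quarter of which lies in `Ω`, and `Ω''` the sets
  -- `Q₁ i ×ˢ {y}` more than a quarter of which lies in `Ω'`.
  set A : ι₂ → Set X₁ := fun j => {x | μ₂ (Q₂ j) < 4 * μ₂ (Q₂ j ∩ Prod.mk x ⁻¹' Ω)} with hA
  have hsec : ∀ j, Measurable fun x => μ₂ (Q₂ j ∩ Prod.mk x ⁻¹' Ω) := fun j => by
    have := measurable_measure_prodMk_left (ν := μ₂)
      ((MeasurableSet.univ.prod (hm₂ j)).inter hΩ : MeasurableSet ((univ : Set X₁) ×ˢ Q₂ j ∩ Ω))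
    convert this using 3 with x
    ext y
    simp
  have hAm : ∀ j, MeasurableSet (A j) := fun j =>
    measurableSet_lt measurable_const ((hsec j).const_mul 4)
  set Ω' : Set (X₁ × X₂) := ⋃ j, A j ×ˢ Q₂ j with hΩ'
  have hΩ'm : MeasurableSet Ω' := .iUnion fun j => (hAm j).prod (hm₂ j)
  have hΩ'le : μ₁.prod μ₂ Ω' ≤ 4 * μ₁.prod μ₂ Ω := by
    rw [Measure.prod_apply hΩ'm, Measure.prod_apply hΩ,
      ← lintegral_const_mul _ (measurable_measure_prodMk_left hΩ)]
    refine lintegral_mono fun x => ?_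
    refine le_trans (measure_mono ?_) (h₂.measure_union_dense_le hm₂ μ₂ (Prod.mk x ⁻¹' Ω) 4)
    intro y hy
    obtain ⟨j, hj⟩ := mem_iUnion.1 hy
    exact mem_biUnion (x := j) hj.1 hj.2
  set B : ι₁ → Set X₂ := fun i => {y | μ₁ (Q₁ i) < 4 * μ₁ (Q₁ i ∩ (fun x => (x, y)) ⁻¹' Ω')} with hB
  have hsec' : ∀ i, Measurable fun y => μ₁ (Q₁ i ∩ (fun x => (x, y)) ⁻¹' Ω') := fun i => by
    have := measurable_measure_prodMk_right (μ := μ₁)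
      (((hm₁ i).prod MeasurableSet.univ).inter hΩ'm : MeasurableSet (Q₁ i ×ˢ (univ : Set X₂) ∩ Ω'))
    convert this using 3 with y
    ext x
    simp
  have hBm : ∀ i, MeasurableSet (B i) := fun i =>
    measurableSet_lt measurable_const ((hsec' i).const_mul 4)
  set Ω'' : Set (X₁ × X₂) := ⋃ i, Q₁ i ×ˢ B i
  have hΩ''m : MeasurableSet Ω'' := .iUnion fun i => (hm₁ i).prod (hBm i)
  have hΩ''le : μ₁.prod μ₂ Ω'' ≤ 4 * μ₁.prod μ₂ Ω' := by
    rw [Measure.prod_apply_symm hΩ''m, Measure.prod_apply_symm hΩ'm,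
      ← lintegral_const_mul _ (measurable_measure_prodMk_right hΩ'm)]
    refine lintegral_mono fun y => ?_
    refine le_trans (measure_mono ?_)
      (h₁.measure_union_dense_le hm₁ μ₁ ((fun x => (x, y)) ⁻¹' Ω') 4)
    intro x hx
    obtain ⟨i, hi⟩ := mem_iUnion.1 hx
    exact mem_biUnion (x := i) hi.2 hi.1
  have hsub : (⋃ i ∈ {i : ι₁ × ι₂ | μ₁.prod μ₂ (Q₁ i.1 ×ˢ Q₂ i.2) <
      2 * μ₁.prod μ₂ ((Q₁ i.1 ×ˢ Q₂ i.2) ∩ Ω)}, Q₁ i.1 ×ˢ Q₂ i.2) ⊆ Ω'' := by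
    rintro ⟨x, y⟩ hxy
    obtain ⟨⟨i, j⟩, hij, hxy⟩ := mem_iUnion₂.1 hxy
    obtain ⟨hx, hy⟩ : x ∈ Q₁ i ∧ y ∈ Q₂ j := hxy
    refine mem_iUnion.2 ⟨i, hx, ?_⟩
    have hincl : Q₁ i ∩ A j ⊆ Q₁ i ∩ (fun x => (x, y)) ⁻¹' Ω' := fun z hz =>
      ⟨hz.1, mem_iUnion.2 ⟨j, hz.2, hy⟩⟩
    refine lt_of_lt_of_le ?_ (mul_le_mul_right (measure_mono hincl) 4)
    -- The average over `Q₁ i` of the density of `Ω` in `{x} ×ˢ Q₂ j` is at most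
    -- `μ₁ (Q₁ i ∩ A j) / μ₁ (Q₁ i) + 1 / 4`.
    have hint : μ₁.prod μ₂ ((Q₁ i ×ˢ Q₂ j) ∩ Ω) ≤
        μ₂ (Q₂ j) * μ₁ (Q₁ i ∩ A j) + μ₂ (Q₂ j) / 4 * μ₁ (Q₁ i) := by
      rw [Measure.prod_apply (((hm₁ i).prod (hm₂ j)).inter hΩ)]
      calc ∫⁻ x, μ₂ (Prod.mk x ⁻¹' ((Q₁ i ×ˢ Q₂ j) ∩ Ω)) ∂μ₁
          ≤ ∫⁻ x, ((Q₁ i ∩ A j).indicator (fun _ => μ₂ (Q₂ j)) x +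
              (Q₁ i).indicator (fun _ => μ₂ (Q₂ j) / 4) x) ∂μ₁ := by
            refine lintegral_mono fun z => ?_
            by_cases hz : z ∈ Q₁ i
            · have he : Prod.mk z ⁻¹' ((Q₁ i ×ˢ Q₂ j) ∩ Ω) = Q₂ j ∩ Prod.mk z ⁻¹' Ω := by
                ext w
                simp [hz]
              rw [he]
              by_cases hzA : z ∈ A j
              · have hz' : z ∈ Q₁ i ∩ A j := ⟨hz, hzA⟩
                rw [indicator_of_mem hz']
                exact (measure_mono inter_subset_left).trans le_self_add
              · rw [indicator_of_notMem fun h => hzA h.2, indicator_of_mem hz, zero_add]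
                rw [ENNReal.le_div_iff_mul_le (.inl (by norm_num)) (.inl (by norm_num)), mul_comm]
                exact not_lt.1 hzA
            · have he : Prod.mk z ⁻¹' ((Q₁ i ×ˢ Q₂ j) ∩ Ω) = ∅ := by
                ext w
                simp [hz]
              simp [he]
        _ = _ := by
            rw [lintegral_add_left (measurable_const.indicator ((hm₁ i).inter (hAm j))),
              lintegral_indicator_const ((hm₁ i).inter (hAm j)), lintegral_indicator_const (hm₁ i)]
    have hlt := lt_of_lt_of_le hij.out (mul_le_mul_right hint 2)
    rw [Measure.prod_prod] at hlt
    have ha : μ₁ (Q₁ i ∩ A j) ≠ ∞ :=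
      ne_top_of_le_ne_top (hf₁ i) (measure_mono inter_subset_left)
    have hp := hp₂ j
    have hf1 := hf₁ i
    have hf2 := hf₂ j
    generalize μ₁ (Q₁ i ∩ A j) = a at hlt ha ⊢
    simp only at hlt
    generalize μ₁ (Q₁ i) = p at hlt hf1 ⊢
    generalize μ₂ (Q₂ j) = q at hlt hp hf2
    lift a to ℝ≥0 using ha
    lift p to ℝ≥0 using hf1
    lift q to ℝ≥0 using hf2
    have hlt' : p * q < 2 * (q * a + q / 4 * p) := by
      have h4 : (q : ℝ≥0∞) / 4 = ((q / 4 : ℝ≥0) : ℝ≥0∞) := by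
        rw [ENNReal.coe_div (by norm_num)]
        norm_num
      rw [h4] at hlt
      exact_mod_cast hlt
    have hq : 0 < q := pos_iff_ne_zero.2 (by simpa using hp)
    have : p < 4 * a := by
      by_contra! hcon
      have h1 : (p : ℝ) * q < 2 * (q * a + q / 4 * p) := by exact_mod_cast hlt'
      have h2 : (4 : ℝ) * a ≤ p := by exact_mod_cast hcon
      have h3 : (0 : ℝ) < q := by exact_mod_cast hq
      nlinarith
    exact_mod_cast this
  calc _ ≤ μ₁.prod μ₂ Ω'' := measure_mono hsub
    _ ≤ 4 * (4 * μ₁.prod μ₂ Ω) := hΩ''le.trans (by gcongr)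
    _ = 16 * μ₁.prod μ₂ Ω := by rw [← mul_assoc]; norm_num

end Maximal

/-! ### The duality estimate -/

section Estimate

theorem sq_rpow_half (x : ℝ≥0∞) : (x ^ (1 / 2 : ℝ)) ^ 2 = x := by
  rw [← ENNReal.rpow_natCast, ← ENNReal.rpow_mul]
  norm_num

theorem rpow_half_sq (x : ℝ≥0∞) : (x ^ 2) ^ (1 / 2 : ℝ) = x := by
  rw [← ENNReal.rpow_natCast, ← ENNReal.rpow_mul]
  norm_num

theorem tsum_mul_le_sqrt_mul_sqrt {I : Type*} (a b : I → ℝ≥0∞) :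
    ∑' i, a i * b i ≤ (∑' i, a i ^ 2) ^ (1 / 2 : ℝ) * (∑' i, b i ^ 2) ^ (1 / 2 : ℝ) := by
  let _ : MeasurableSpace I := ⊤
  have h := ENNReal.lintegral_mul_le_Lp_mul_Lq (Measure.count : Measure I)
    Real.HolderConjugate.two_two (f := a) (g := b) measurable_from_top.aemeasurable measurable_from_top.aemeasurable
  simpa [lintegral_count] using h

variable {Y : Type*} [MeasurableSpace Y] {μ : Measure Y}

/-- A median level `l` of `S` on `R`, up to a factor `2`: the level `l` is exceeded on more than
half of `R`, and the level `2 * l` on at most half of `R`. -/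
theorem exists_median_level {S : Y → ℝ≥0∞} (hS : Measurable S) (hSi : ∫⁻ y, S y ∂μ ≠ ∞) {R : Set Y}
    (hR0 : μ R ≠ 0) (hRt : μ R ≠ ∞) {c : ℝ} (hc : 0 < c)
    (hcS : ∀ y ∈ R, ENNReal.ofReal c ≤ S y) :
    ∃ l : ℝ, 0 < l ∧ μ R < 2 * μ (R ∩ {y | ENNReal.ofReal l < S y}) ∧
      2 * μ (R ∩ {y | ENNReal.ofReal (2 * l) < S y}) ≤ μ R := by
  set A : Set ℝ := {l | 0 < l ∧ μ R < 2 * μ (R ∩ {y | ENNReal.ofReal l < S y})} with hA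
  have hmem : c / 2 ∈ A := by
    refine ⟨by positivity, ?_⟩
    have : R ∩ {y | ENNReal.ofReal (c / 2) < S y} = R := by
      refine inter_eq_left.2 fun y hy => lt_of_lt_of_le ?_ (hcS y hy)
      exact (ENNReal.ofReal_lt_ofReal_iff hc).2 (by linarith)
    rw [this, two_mul]
    exact ENNReal.lt_add_right hRt hR0
  have hbdd : BddAbove A := by
    refine ⟨(2 * (∫⁻ y, S y ∂μ) / μ R).toReal, fun l hl => ?_⟩
    rw [← ENNReal.ofReal_le_iff_le_toReal
        (ENNReal.div_ne_top (ENNReal.mul_ne_top (by simp) hSi) hR0),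
      ENNReal.le_div_iff_mul_le (.inl hR0) (.inl hRt)]
    calc ENNReal.ofReal l * μ R
        ≤ ENNReal.ofReal l * (2 * μ {y | ENNReal.ofReal l ≤ S y}) := by
          refine mul_le_mul_right (hl.2.le.trans (mul_le_mul_right (measure_mono ?_) 2)) _
          exact fun y hy => hy.2.out.le
      _ = 2 * (ENNReal.ofReal l * μ {y | ENNReal.ofReal l ≤ S y}) := mul_left_comm _ _ _
      _ ≤ _ := mul_le_mul_right (mul_meas_ge_le_lintegral hS _) 2
  have hs : 0 < sSup A := (half_pos hc).trans_le (le_csSup hbdd hmem)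
  obtain ⟨l, hl, hlt⟩ := exists_lt_of_lt_csSup ⟨_, hmem⟩ (half_lt_self hs)
  refine ⟨l, hl.1, hl.2, not_lt.1 fun h => ?_⟩
  have := le_csSup hbdd (show 2 * l ∈ A from ⟨mul_pos two_pos hl.1, h⟩)
  linarith

theorem lintegral_meas_ofReal_lt {S : Y → ℝ≥0∞} (hS : Measurable S) (hSi : ∫⁻ y, S y ∂μ ≠ ∞) :
    ∫⁻ t in Ioi (0 : ℝ), μ {y | ENNReal.ofReal t < S y} = ∫⁻ y, S y ∂μ := by
  have hfin : ∀ᵐ y ∂μ, S y < ∞ := ae_lt_top hS hSi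
  have h := lintegral_eq_lintegral_meas_lt μ (f := fun y => (S y).toReal)
    (ae_of_all _ fun _ => ENNReal.toReal_nonneg) hS.ennreal_toReal.aemeasurable
  have h1 : ∫⁻ y, ENNReal.ofReal (S y).toReal ∂μ = ∫⁻ y, S y ∂μ :=
    lintegral_congr_ae (by filter_upwards [hfin] with y hy using ENNReal.ofReal_toReal hy.ne)
  rw [← h1, h]
  refine setLIntegral_congr_fun measurableSet_Ioi fun t ht => measure_congr ?_
  filter_upwards [hfin] with y hy
  exact propext (ENNReal.ofReal_lt_iff_lt_toReal (le_of_lt ht) hy.ne)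

/-- If `l` is a median level of `S` on `R`, then `1 / l` is controlled by the mean of `1 / S`. -/
theorem inv_le_lintegral_indicator_inv {S : Y → ℝ≥0∞} (hS : Measurable S) {R : Set Y}
    (hR : MeasurableSet R) (hR0 : μ R ≠ 0) (hRt : μ R ≠ ∞) {l : ℝ}
    (h : 2 * μ (R ∩ {y | ENNReal.ofReal (2 * l) < S y}) ≤ μ R) (a : ℝ≥0∞) :
    a * (ENNReal.ofReal l)⁻¹ ≤ 4 * ∫⁻ y, R.indicator (fun _ => a / μ R) y * (S y)⁻¹ ∂μ := by
  set G : Set Y := {y | ENNReal.ofReal (2 * l) < S y}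
  have hGm : MeasurableSet G := measurableSet_lt measurable_const hS
  have hhalf : μ R ≤ 2 * μ (R \ G) := by
    have hsum := measure_inter_add_sdiff (μ := μ) R hGm
    refine (ENNReal.add_le_add_iff_left hRt).1 ?_
    calc μ R + μ R = 2 * μ (R ∩ G) + 2 * μ (R \ G) := by rw [← mul_add, hsum, two_mul]
      _ ≤ _ := add_le_add_left h _
  have hlow : a / μ R * (ENNReal.ofReal (2 * l))⁻¹ * μ (R \ G) ≤
      ∫⁻ y, R.indicator (fun _ => a / μ R) y * (S y)⁻¹ ∂μ := by
    rw [← lintegral_indicator_const (hR.diff hGm)]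
    refine lintegral_mono fun y => ?_
    by_cases hy : y ∈ R \ G
    · rw [indicator_of_mem hy, indicator_of_mem hy.1]
      exact mul_le_mul_right (ENNReal.inv_le_inv.2 (not_lt.1 hy.2)) _
    · simp [indicator_of_notMem hy]
  have h2l : ENNReal.ofReal (2 * l) = 2 * ENNReal.ofReal l := by
    rw [ENNReal.ofReal_mul two_pos.le]
    simp
  have hcancel : (μ R)⁻¹ * μ R = 1 := ENNReal.inv_mul_cancel hR0 hRt
  have h22 : (2 : ℝ≥0∞) * 2⁻¹ = 1 := ENNReal.mul_inv_cancel (by simp) (by simp)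
  calc a * (ENNReal.ofReal l)⁻¹
      = a * (ENNReal.ofReal l)⁻¹ * ((μ R)⁻¹ * μ R) * (2 * 2⁻¹) := by
        rw [hcancel, h22, mul_one, mul_one]
    _ ≤ a * (ENNReal.ofReal l)⁻¹ * ((μ R)⁻¹ * (2 * μ (R \ G))) * (2 * 2⁻¹) := by gcongr
    _ = 4 * (a / μ R * (ENNReal.ofReal (2 * l))⁻¹ * μ (R \ G)) := by
        rw [h2l, ENNReal.mul_inv (.inl (by simp)) (.inl (by simp)), div_eq_mul_inv,
          show (4 : ℝ≥0∞) = 2 * 2 by norm_num]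
        ring
    _ ≤ _ := mul_le_mul_right hlow 4

/-- The duality of `s¹` and `c¹` for an abstract countable family of sets `R i` whose maximal
function satisfies a weak type inequality for sets. With `l i` a median level of the square function
`S` on `R i`, the Cauchy–Schwarz inequality with weights `l i` leaves `∑ (a i)² / l i`, which is at
most `4 ∫ S² / S`, and `∑ l i * (b i)²`, which is estimated by integrating the Carleson condition
over the level sets of `S`. -/
theorem tsum_mul_le_of_carleson {I : Type*} [Countable I] {R : I → Set Y}
    (hRm : ∀ i, MeasurableSet (R i)) (hR0 : ∀ i, μ (R i) ≠ 0) (hRt : ∀ i, μ (R i) ≠ ∞)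
    {K N : ℝ≥0∞} (hK : K ≠ ∞)
    (hmax : ∀ E, MeasurableSet E → μ (⋃ i ∈ {i | μ (R i) < 2 * μ (R i ∩ E)}, R i) ≤ K * μ E)
    {a b : I → ℝ≥0∞} (ha : ∀ i, a i ≠ ∞)
    (hb : ∀ E : Set Y, μ E ≠ ∞ → ∑' i : {i // R i ⊆ E}, b i ^ 2 ≤ N * μ E)
    {S : Y → ℝ≥0∞} (hS : Measurable S) (hSi : ∫⁻ y, S y ∂μ ≠ ∞)
    (hSq : ∀ y, S y ^ 2 = ∑' i, (R i).indicator (fun _ => a i ^ 2 / μ (R i)) y) :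
    ∑' i, a i * b i ≤ (4 * ∫⁻ y, S y ∂μ) ^ (1 / 2 : ℝ) * (N * K * ∫⁻ y, S y ∂μ) ^ (1 / 2 : ℝ) := by
  have hlev : ∀ i, ∃ l : ℝ, (a i = 0 → l = 0) ∧ (a i ≠ 0 → 0 < l ∧
      μ (R i) < 2 * μ (R i ∩ {y | ENNReal.ofReal l < S y}) ∧
      2 * μ (R i ∩ {y | ENNReal.ofReal (2 * l) < S y}) ≤ μ (R i)) := by
    intro i
    by_cases hi : a i = 0
    · exact ⟨0, fun _ => rfl, fun h => absurd hi h⟩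
    -- On `R i` the square function is at least the term of index `i`.
    have hq : a i ^ 2 / μ (R i) ≠ 0 := ENNReal.div_ne_zero.2 ⟨pow_ne_zero 2 hi, hRt i⟩
    have hq' : a i ^ 2 / μ (R i) ≠ ∞ := ENNReal.div_ne_top (ENNReal.pow_ne_top (ha i)) (hR0 i)
    set c : ℝ≥0∞ := (a i ^ 2 / μ (R i)) ^ (1 / 2 : ℝ)
    have hc2 : c ^ 2 = a i ^ 2 / μ (R i) := sq_rpow_half _
    have hct : c ≠ ∞ := ENNReal.rpow_ne_top_of_nonneg (by norm_num) hq'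
    have hc0 : c ≠ 0 := fun h => hq (by rw [← hc2, h]; simp)
    obtain ⟨l, hl⟩ := exists_median_level hS hSi (hR0 i) (hRt i) (ENNReal.toReal_pos hc0 hct)
      (fun y hy => by
        rw [ENNReal.ofReal_toReal hct, ← (ENNReal.pow_right_strictMono two_ne_zero).le_iff_le]
        rw [hc2, hSq y]
        refine le_trans ?_ (ENNReal.le_tsum i)
        rw [indicator_of_mem hy])
    exact ⟨l, fun h => absurd h hi, fun _ => hl⟩
  choose l hl0 hl using hlev
  have hfirst : ∑' i, a i ^ 2 * (ENNReal.ofReal (l i))⁻¹ ≤ 4 * ∫⁻ y, S y ∂μ := by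
    calc ∑' i, a i ^ 2 * (ENNReal.ofReal (l i))⁻¹
        ≤ ∑' i, 4 * ∫⁻ y, (R i).indicator (fun _ => a i ^ 2 / μ (R i)) y * (S y)⁻¹ ∂μ := by
          refine ENNReal.tsum_le_tsum fun i => ?_
          by_cases hi : a i = 0
          · simp [hi]
          · exact inv_le_lintegral_indicator_inv hS (hRm i) (hR0 i) (hRt i)
              (hl i hi).2.2 _
      _ = 4 * ∫⁻ y, S y ^ 2 * (S y)⁻¹ ∂μ := by
          have hm : ∀ i, AEMeasurable
              (fun y => (R i).indicator (fun _ => a i ^ 2 / μ (R i)) y * (S y)⁻¹) μ := fun i =>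
            ((measurable_const.indicator (hRm i)).mul hS.inv).aemeasurable
          rw [ENNReal.tsum_mul_left, ← lintegral_tsum hm]
          simp_rw [ENNReal.tsum_mul_right, ← hSq]
      _ ≤ 4 * ∫⁻ y, S y ∂μ := by
          refine mul_le_mul_right (lintegral_mono fun y => ?_) 4
          simp only [pow_two, mul_assoc]
          exact mul_le_of_le_one_right' (ENNReal.mul_inv_le_one _)
  have hsecond : ∑' i, ENNReal.ofReal (l i) * b i ^ 2 ≤ N * K * ∫⁻ y, S y ∂μ := by
    have hterm : ∀ i, ENNReal.ofReal (l i) * b i ^ 2 =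
        ∫⁻ t in Ioi (0 : ℝ), (Iio (l i)).indicator (fun _ => b i ^ 2) t := by
      intro i
      rw [lintegral_indicator_const measurableSet_Iio,
        Measure.restrict_apply measurableSet_Iio, inter_comm, Ioi_inter_Iio, Real.volume_Ioo,
        sub_zero, mul_comm]
    simp_rw [hterm]
    rw [← lintegral_tsum fun i => (measurable_const.indicator measurableSet_Iio).aemeasurable,
      ← lintegral_meas_ofReal_lt hS hSi, mul_assoc]
    have hanti : Antitone fun t : ℝ => μ {y | ENNReal.ofReal t < S y} := fun t t' htt' =>
      measure_mono fun y hy => (ENNReal.ofReal_le_ofReal htt').trans_lt hy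
    rw [← lintegral_const_mul _ hanti.measurable,
      ← lintegral_const_mul _ (hanti.measurable.const_mul K)]
    refine setLIntegral_mono' measurableSet_Ioi fun t ht => ?_
    set E : Set Y := {y | ENNReal.ofReal t < S y} with hE
    have hEt : μ E ≠ ∞ := by
      have ht0 : ENNReal.ofReal t ≠ 0 := (ENNReal.ofReal_pos.2 ht).ne'
      exact ne_top_of_le_ne_top (ENNReal.div_ne_top hSi ht0)
        ((measure_mono fun y hy => hy.out.le).trans
          (meas_ge_le_lintegral_div hS.aemeasurable ht0 ENNReal.ofReal_ne_top))
    set U : Set Y := ⋃ i ∈ {i | μ (R i) < 2 * μ (R i ∩ E)}, R i with hU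
    have hUle : μ U ≤ K * μ E := hmax E (measurableSet_lt measurable_const hS)
    calc ∑' i, (Iio (l i)).indicator (fun _ => b i ^ 2) t
        ≤ ∑' i, {i | R i ⊆ U}.indicator (fun i => b i ^ 2) i := by
          refine ENNReal.tsum_le_tsum fun i => ?_
          by_cases hti : t ∈ Iio (l i)
          · -- The level `t` is below the median level of `S` on `R i`.
            have hi : a i ≠ 0 := fun h => by
              rw [hl0 i h] at hti
              exact lt_asymm (mem_Iio.1 hti) (mem_Ioi.1 ht)
            have hRU : R i ⊆ U := by
              refine subset_biUnion_of_mem (u := R) (?_ : μ (R i) < 2 * μ (R i ∩ E))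
              refine (hl i hi).2.1.trans_le (mul_le_mul_right (measure_mono ?_) 2)
              exact inter_subset_inter_right _ fun y hy =>
                (ENNReal.ofReal_le_ofReal (le_of_lt hti)).trans_lt hy
            rw [indicator_of_mem hti, indicator_of_mem (show i ∈ {i | R i ⊆ U} from hRU)]
          · simp [indicator_of_notMem hti]
      _ = ∑' i : {i // R i ⊆ U}, b i ^ 2 := (tsum_subtype {i | R i ⊆ U} fun i => b i ^ 2).symm
      _ ≤ N * μ U := hb U (ne_top_of_le_ne_top (ENNReal.mul_ne_top hK hEt) hUle)
      _ ≤ N * (K * μ E) := mul_le_mul_right hUle N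
  have hprod : ∀ i, a i * b i = a i * (ENNReal.ofReal (l i))⁻¹ ^ (1 / 2 : ℝ) *
      (ENNReal.ofReal (l i) ^ (1 / 2 : ℝ) * b i) := by
    intro i
    by_cases hi : a i = 0
    · simp [hi]
    · have h0 : ENNReal.ofReal (l i) ≠ 0 := (ENNReal.ofReal_pos.2 (hl i hi).1).ne'
      have : (ENNReal.ofReal (l i))⁻¹ ^ (1 / 2 : ℝ) * ENNReal.ofReal (l i) ^ (1 / 2 : ℝ) = 1 := by
        rw [← ENNReal.mul_rpow_of_nonneg _ _ (by norm_num),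
          ENNReal.inv_mul_cancel h0 ENNReal.ofReal_ne_top, ENNReal.one_rpow]
      rw [mul_assoc, ← mul_assoc _ _ (b i), this, one_mul]
  calc ∑' i, a i * b i = _ := tsum_congr hprod
    _ ≤ _ := tsum_mul_le_sqrt_mul_sqrt _ _
    _ ≤ _ := by
        simp_rw [mul_pow, sq_rpow_half]
        exact mul_le_mul' (ENNReal.rpow_le_rpow hfirst (by norm_num))
          (ENNReal.rpow_le_rpow hsecond (by norm_num))

end Estimate

/-! ### Dyadic rectangles -/

section Rectangles

variable {X₁ X₂ : Type*} [MeasurableSpace X₁] [MeasurableSpace X₂]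
  {ρ₁ : X₁ → X₁ → ℝ} {ρ₂ : X₂ → X₂ → ℝ} {μ₁ : Measure X₁} {μ₂ : Measure X₂}
  {D₁ : DyadicSystem ρ₁} {D₂ : DyadicSystem ρ₂}

/-- The dyadic rectangle `Q₁ × Q₂` of a pair of Haar indices. -/
def haarRect (i : HaarIndex D₁ × HaarIndex D₂) : Set (X₁ × X₂) := i.1.cube ×ˢ i.2.cube

theorem measurableSet_haarRect (i : HaarIndex D₁ × HaarIndex D₂) :
    MeasurableSet (haarRect i) :=
  (D₁.measurableSet_cube _ _).prod (D₂.measurableSet_cube _ _)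

theorem normIndicator_sq {X : Type*} [MeasurableSpace X] (μ : Measure X) (Q : Set X) (x : X) :
    normIndicator μ Q x ^ 2 = Q.indicator (fun _ => (μ Q)⁻¹) x := by
  by_cases hx : x ∈ Q
  · rw [normIndicator, indicator_of_mem hx, indicator_of_mem hx, ENNReal.rpow_neg,
      ← ENNReal.inv_pow, sq_rpow_half]
  · simp [normIndicator, hx]

variable [TopologicalSpace X₁] [TopologicalSpace X₂]

theorem IsHomogeneousType.sigmaFinite (h₁ : IsHomogeneousType ρ₁ μ₁) (D₁ : DyadicSystem ρ₁) :
    SigmaFinite μ₁ := by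
  have := h₁.isQuasiMetric.secondCountableTopology D₁
  have := h₁.isLocallyFiniteMeasure
  infer_instance

/-- Sets in the product are approximated in measure by open sets from outside, since the product is
a second countable pseudometrizable space with a locally finite Borel measure. -/
theorem outerRegular_prod (h₁ : IsHomogeneousType ρ₁ μ₁) (h₂ : IsHomogeneousType ρ₂ μ₂)
    (D₁ : DyadicSystem ρ₁) (D₂ : DyadicSystem ρ₂) : (μ₁.prod μ₂).OuterRegular := by
  have := h₁.isQuasiMetric.secondCountableTopology D₁
  have := h₂.isQuasiMetric.secondCountableTopology D₂
  have := h₁.isQuasiMetric.pseudoMetrizableSpace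
  have := h₂.isQuasiMetric.pseudoMetrizableSpace
  have := h₁.isLocallyFiniteMeasure
  have := h₂.isLocallyFiniteMeasure
  have := h₁.borelSpace
  have := h₂.borelSpace
  infer_instance

theorem measure_haarRect_ne_zero (h₁ : IsHomogeneousType ρ₁ μ₁) (h₂ : IsHomogeneousType ρ₂ μ₂)
    (i : HaarIndex D₁ × HaarIndex D₂) : μ₁.prod μ₂ (haarRect i) ≠ 0 := by
  have := h₂.sigmaFinite D₂
  rw [haarRect, Measure.prod_prod]
  exact mul_ne_zero (h₁.measure_cube_pos D₁ _ _).ne' (h₂.measure_cube_pos D₂ _ _).ne'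

theorem measure_haarRect_ne_top (h₁ : IsHomogeneousType ρ₁ μ₁) (h₂ : IsHomogeneousType ρ₂ μ₂)
    (i : HaarIndex D₁ × HaarIndex D₂) : μ₁.prod μ₂ (haarRect i) ≠ ∞ := by
  have := h₂.sigmaFinite D₂
  rw [haarRect, Measure.prod_prod]
  exact ENNReal.mul_ne_top (h₁.measure_cube_lt_top D₁ _ _).ne (h₂.measure_cube_lt_top D₂ _ _).ne

theorem squareFunction_sq (h₁ : IsHomogeneousType ρ₁ μ₁) (h₂ : IsHomogeneousType ρ₂ μ₂)
    (s : HaarSeq D₁ D₂) (x : X₁ × X₂) : squareFunction μ₁ μ₂ s x ^ 2 =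
      ∑' i, (haarRect i).indicator (fun _ => ‖s i‖ₑ ^ 2 / μ₁.prod μ₂ (haarRect i)) x := by
  have := h₂.sigmaFinite D₂
  rw [squareFunction, sq_rpow_half]
  refine tsum_congr fun i => ?_
  rw [mul_pow, mul_pow, normIndicator_sq, normIndicator_sq]
  by_cases hx : x ∈ haarRect i
  · rw [indicator_of_mem hx, indicator_of_mem hx.1, indicator_of_mem hx.2, haarRect,
      Measure.prod_prod, div_eq_mul_inv, ENNReal.mul_inv
        (.inl (h₁.measure_cube_pos D₁ i.1.1 i.1.2.1).ne' : μ₁ i.1.cube ≠ 0 ∨ _)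
        (.inl (h₁.measure_cube_lt_top D₁ i.1.1 i.1.2.1).ne : μ₁ i.1.cube ≠ ∞ ∨ _)]
  · rw [indicator_of_notMem hx]
    rcases not_and_or.1 hx with h | h <;> simp [h]

theorem lintegral_squareFunction_sq (h₁ : IsHomogeneousType ρ₁ μ₁) (h₂ : IsHomogeneousType ρ₂ μ₂)
    (s : HaarSeq D₁ D₂) :
    ∫⁻ x, squareFunction μ₁ μ₂ s x ^ 2 ∂μ₁.prod μ₂ = ∑' i, ‖s i‖ₑ ^ 2 := by
  simp_rw [squareFunction_sq h₁ h₂]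
  rw [lintegral_tsum fun i => (measurable_const.indicator (measurableSet_haarRect i)).aemeasurable]
  refine tsum_congr fun i => ?_
  rw [lintegral_indicator_const (measurableSet_haarRect i)]
  exact ENNReal.div_mul_cancel (measure_haarRect_ne_zero h₁ h₂ i) (measure_haarRect_ne_top h₁ h₂ i)

/-- By the Cauchy–Schwarz inequality, since the square function vanishes off `Ω`. -/
theorem s1Norm_le_of_support (h₁ : IsHomogeneousType ρ₁ μ₁) (h₂ : IsHomogeneousType ρ₂ μ₂)
    {s : HaarSeq D₁ D₂} {Ω : Set (X₁ × X₂)} (hs : ∀ i, s i ≠ 0 → haarRect i ⊆ Ω) :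
    s1Norm μ₁ μ₂ s ≤ (∑' i, ‖s i‖ₑ ^ 2) ^ (1 / 2 : ℝ) * μ₁.prod μ₂ Ω ^ (1 / 2 : ℝ) := by
  set T := toMeasurable (μ₁.prod μ₂) Ω
  have hT : MeasurableSet T := measurableSet_toMeasurable _ _
  have hST : ∀ x, squareFunction μ₁ μ₂ s x = squareFunction μ₁ μ₂ s x * T.indicator 1 x := by
    intro x
    by_cases hx : x ∈ T
    · simp [hx]
    · rw [indicator_of_notMem hx, mul_zero, ← rpow_half_sq (squareFunction μ₁ μ₂ s x),
        squareFunction_sq h₁ h₂]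
      have h0 : ∀ i, (haarRect i).indicator
          (fun _ => ‖s i‖ₑ ^ 2 / μ₁.prod μ₂ (haarRect i)) x = 0 := by
        intro i
        by_cases hi : s i = 0
        · simp [hi]
        · exact indicator_of_notMem (fun h => hx (subset_toMeasurable _ _ (hs i hi h))) _
      simp [h0]
  have hCS := ENNReal.lintegral_mul_le_Lp_mul_Lq (μ₁.prod μ₂) Real.HolderConjugate.two_two
    (measurable_squareFunction μ₁ μ₂ s).aemeasurable
    ((measurable_one : Measurable (1 : X₁ × X₂ → ℝ≥0∞)).indicator hT).aemeasurable
  have hind : ∀ x, T.indicator (1 : X₁ × X₂ → ℝ≥0∞) x ^ (2 : ℝ) = T.indicator 1 x := by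
    intro x
    by_cases hx : x ∈ T <;> simp [hx]
  simp_rw [Pi.mul_apply, ← hST, hind, ENNReal.rpow_two, lintegral_squareFunction_sq h₁ h₂,
    lintegral_indicator_one hT, T, measure_toMeasurable] at hCS
  exact hCS

/-- The Carleson condition, imposed on open sets, holds for all sets of finite measure. -/
theorem tsum_sq_le_c1Norm (h₁ : IsHomogeneousType ρ₁ μ₁) (h₂ : IsHomogeneousType ρ₂ μ₂)
    {t : HaarSeq D₁ D₂} (ht : c1Norm μ₁ μ₂ t ≠ ∞) (E : Set (X₁ × X₂)) (hE : μ₁.prod μ₂ E ≠ ∞) :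
    ∑' i : {i : HaarIndex D₁ × HaarIndex D₂ // haarRect i ⊆ E}, ‖t i‖ₑ ^ 2 ≤
      c1Norm μ₁ μ₂ t ^ 2 * μ₁.prod μ₂ E := by
  have := outerRegular_prod h₁ h₂ D₁ D₂
  have hopen : ∀ O : Set (X₁ × X₂), IsOpen O → μ₁.prod μ₂ O < ∞ →
      ∑' i : {i : HaarIndex D₁ × HaarIndex D₂ // haarRect i ⊆ O}, ‖t i‖ₑ ^ 2 ≤
        c1Norm μ₁ μ₂ t ^ 2 * μ₁.prod μ₂ O := by
    intro O hO hOt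
    by_cases h0 : μ₁.prod μ₂ O = 0
    · -- A null set contains no rectangle.
      have : IsEmpty {i : HaarIndex D₁ × HaarIndex D₂ // haarRect i ⊆ O} :=
        ⟨fun i => measure_haarRect_ne_zero h₁ h₂ i.1 (measure_mono_null i.2 h0)⟩
      simp
    · have hle : carleson μ₁ μ₂ t O ≤ c1Norm μ₁ μ₂ t :=
        le_iSup_of_le O (le_iSup_of_le hO (le_iSup_of_le hOt le_rfl))
      have hsq := pow_le_pow_left' hle 2
      rw [carleson, sq_rpow_half, mul_comm, ← div_eq_mul_inv,
        ENNReal.div_le_iff_le_mul (.inl h0) (.inl hOt.ne)] at hsq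
      exact hsq
  by_contra! hcon
  have hN : c1Norm μ₁ μ₂ t ^ 2 ≠ ∞ := ENNReal.pow_ne_top ht
  set A := ∑' i : {i : HaarIndex D₁ × HaarIndex D₂ // haarRect i ⊆ E}, ‖t i‖ₑ ^ 2 with hA
  have hA0 : A ≠ 0 := (pos_of_gt hcon).ne'
  rw [mul_comm, ← ENNReal.lt_div_iff_mul_lt (.inr hE) (.inl hN)] at hcon
  obtain ⟨O, hEO, hO, hOlt⟩ := E.exists_isOpen_lt_of_lt _ hcon
  have hOt : μ₁.prod μ₂ O < ∞ := hOlt.trans_le le_top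
  rw [ENNReal.lt_div_iff_mul_lt (.inr hOt.ne) (.inl hN), mul_comm] at hOlt
  refine absurd (hOlt.trans_le ?_) (not_lt.2 (hopen O hO hOt))
  exact ENNReal.tsum_mono_subtype (fun i => ‖t i‖ₑ ^ 2)
    (show {i | haarRect i ⊆ E} ⊆ {i | haarRect i ⊆ O} from fun i hi => hi.trans hEO)

theorem tsum_enorm_mul_le (h₁ : IsHomogeneousType ρ₁ μ₁) (h₂ : IsHomogeneousType ρ₂ μ₂)
    {s t : HaarSeq D₁ D₂} (hs : s1Norm μ₁ μ₂ s ≠ ∞) (ht : c1Norm μ₁ μ₂ t ≠ ∞) :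
    ∑' i, ‖s i‖ₑ * ‖t i‖ₑ ≤ 8 * c1Norm μ₁ μ₂ t * s1Norm μ₁ μ₂ s := by
  have := h₁.sigmaFinite D₁
  have := h₂.sigmaFinite D₂
  refine (tsum_mul_le_of_carleson (μ := μ₁.prod μ₂) (R := haarRect) (K := 16)
    measurableSet_haarRect (measure_haarRect_ne_zero h₁ h₂) (measure_haarRect_ne_top h₁ h₂)
    (by norm_num) (fun E hE => ?_) (fun _ => enorm_ne_top) (tsum_sq_le_c1Norm h₁ h₂ ht)
    (measurable_squareFunction μ₁ μ₂ s) hs (squareFunction_sq h₁ h₂ s)).trans_eq ?_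
  · exact measure_iUnion_prod_le (isLaminar_cube D₁) (isLaminar_cube D₂)
      (fun i => D₁.measurableSet_cube _ _) (fun i => D₂.measurableSet_cube _ _) μ₁ μ₂
      (fun i => (h₁.measure_cube_lt_top D₁ _ _).ne) (fun i => (h₂.measure_cube_pos D₂ _ _).ne')
      (fun i => (h₂.measure_cube_lt_top D₂ _ _).ne) hE
  · rw [← ENNReal.mul_rpow_of_nonneg _ _ (by norm_num)]
    change (4 * s1Norm μ₁ μ₂ s * (c1Norm μ₁ μ₂ t ^ 2 * 16 * s1Norm μ₁ μ₂ s)) ^ (1 / 2 : ℝ) = _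
    rw [← rpow_half_sq (8 * c1Norm μ₁ μ₂ t * s1Norm μ₁ μ₂ s)]
    congr 1
    ring

end Rectangles

/-! ### The dual of `s¹` -/

section Dual

variable {X₁ X₂ : Type*} [MeasurableSpace X₁] [MeasurableSpace X₂]
  {ρ₁ : X₁ → X₁ → ℝ} {ρ₂ : X₂ → X₂ → ℝ} {μ₁ : Measure X₁} {μ₂ : Measure X₂}
  {D₁ : DyadicSystem ρ₁} {D₂ : DyadicSystem ρ₂}

variable (μ₁ μ₂ D₁ D₂) in
/-- The inclusion of `s¹` into the space of all sequences. -/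
def S1.toSeq : S1 μ₁ μ₂ D₁ D₂ →ₗ[ℂ] HaarSeq D₁ D₂ := (s1Submodule μ₁ μ₂ D₁ D₂).subtype

theorem S1.s1Norm_ne_top (s : S1 μ₁ μ₂ D₁ D₂) : s1Norm μ₁ μ₂ (S1.toSeq μ₁ μ₂ D₁ D₂ s) ≠ ∞ :=
  ne_of_lt s.2

theorem S1.enorm_eq (s : S1 μ₁ μ₂ D₁ D₂) : ‖s‖ₑ = s1Norm μ₁ μ₂ (S1.toSeq μ₁ μ₂ D₁ D₂ s) := by
  rw [← ofReal_norm]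
  exact ENNReal.ofReal_toReal s.s1Norm_ne_top

variable [TopologicalSpace X₁] [TopologicalSpace X₂]

open Classical in
/-- The unit sequence supported at one index, as an element of `s¹`. -/
noncomputable def S1.single (h₁ : IsHomogeneousType ρ₁ μ₁) (h₂ : IsHomogeneousType ρ₂ μ₂)
    (i : HaarIndex D₁ × HaarIndex D₂) : S1 μ₁ μ₂ D₁ D₂ :=
  ⟨Pi.single i 1, by
    refine (s1Norm_le_of_support h₁ h₂ (Ω := haarRect i) fun j hj => ?_).trans_lt ?_
    · rw [Pi.single_apply, ite_ne_right_iff] at hj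
      rw [hj.1]
    · refine ENNReal.mul_lt_top (ENNReal.rpow_lt_top_of_nonneg (by norm_num) ?_)
        (ENNReal.rpow_lt_top_of_nonneg (by norm_num) (measure_haarRect_ne_top h₁ h₂ i))
      rw [tsum_eq_single i fun j hj => by simp [hj]]
      simp⟩

variable (h₁ : IsHomogeneousType ρ₁ μ₁) (h₂ : IsHomogeneousType ρ₂ μ₂)

open Classical in
theorem S1.toSeq_sum_smul_single (F : Finset (HaarIndex D₁ × HaarIndex D₂))
    (s : HaarSeq D₁ D₂) (j : HaarIndex D₁ × HaarIndex D₂) :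
    S1.toSeq μ₁ μ₂ D₁ D₂ (∑ i ∈ F, s i • S1.single h₁ h₂ i) j = if j ∈ F then s j else 0 := by
  rw [map_sum, Finset.sum_apply]
  have : ∀ i, S1.toSeq μ₁ μ₂ D₁ D₂ (s i • S1.single h₁ h₂ i) j = if j = i then s j else 0 := by
    intro i
    rw [map_smul]
    change s i * (Pi.single i 1 : HaarSeq D₁ D₂) j = _
    rw [Pi.single_apply]
    split_ifs with h
    · rw [h, mul_one]
    · rw [mul_zero]
  simp_rw [this]
  exact Finset.sum_ite_eq F j _

/-- Every element of `s¹` is the unconditional sum of its coordinates, by dominated convergence of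
the square functions of the remainders. -/
theorem S1.hasSum_smul_single (s : S1 μ₁ μ₂ D₁ D₂) :
    HasSum (fun i => s i • S1.single h₁ h₂ i) s := by
  classical
  set v : Finset (HaarIndex D₁ × HaarIndex D₂) → S1 μ₁ μ₂ D₁ D₂ :=
    fun F => ∑ i ∈ F, s i • S1.single h₁ h₂ i with hv
  set f : HaarSeq D₁ D₂ := S1.toSeq μ₁ μ₂ D₁ D₂ s with hf
  have hterm : ∀ F i, ‖S1.toSeq μ₁ μ₂ D₁ D₂ (v F - s) i‖ₑ = if i ∈ F then 0 else ‖f i‖ₑ := by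
    intro F i
    have hvi : S1.toSeq μ₁ μ₂ D₁ D₂ (v F) i = if i ∈ F then f i else 0 :=
      S1.toSeq_sum_smul_single h₁ h₂ F f i
    rw [map_sub, Pi.sub_apply, hvi]
    split_ifs
    · rw [← hf, sub_self, enorm_zero]
    · rw [← hf, zero_sub, enorm_neg]
  have hle : ∀ F x, squareFunction μ₁ μ₂ (S1.toSeq μ₁ μ₂ D₁ D₂ (v F - s)) x ≤
      squareFunction μ₁ μ₂ f x := by
    intro F x
    refine sqrt_tsum_sq_mono fun i => mul_le_mul_left ?_ _
    rw [hterm]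
    split_ifs <;> simp
  have hfin : ∀ᵐ x ∂μ₁.prod μ₂, squareFunction μ₁ μ₂ f x < ∞ :=
    ae_lt_top (measurable_squareFunction μ₁ μ₂ f) s.s1Norm_ne_top
  have hlim : Tendsto (fun F => s1Norm μ₁ μ₂ (S1.toSeq μ₁ μ₂ D₁ D₂ (v F - s))) atTop (𝓝 0) := by
    have h0 : (0 : ℝ≥0∞) = ∫⁻ _, 0 ∂μ₁.prod μ₂ := by simp
    rw [h0]
    refine tendsto_lintegral_filter_of_dominated_convergence (squareFunction μ₁ μ₂ f)
      (.of_forall fun F => measurable_squareFunction μ₁ μ₂ _)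
      (.of_forall fun F => ae_of_all _ (hle F)) s.s1Norm_ne_top ?_
    filter_upwards [hfin] with x hx
    set g : HaarIndex D₁ × HaarIndex D₂ → ℝ≥0∞ := fun i =>
      (‖f i‖ₑ * (normIndicator μ₁ i.1.cube x.1 * normIndicator μ₂ i.2.cube x.2)) ^ 2 with hg
    have hgt : ∑' i, g i ≠ ∞ := by
      have : ∑' i, g i = squareFunction μ₁ μ₂ f x ^ 2 := (sq_rpow_half _).symm
      rw [this]
      exact ENNReal.pow_ne_top hx.ne
    have heq : ∀ F : Finset _, squareFunction μ₁ μ₂ (S1.toSeq μ₁ μ₂ D₁ D₂ (v F - s)) x =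
        (∑' i : {i // i ∉ F}, g i) ^ (1 / 2 : ℝ) := by
      intro F
      rw [squareFunction]
      congr 1
      rw [show ∑' i : {i // i ∉ F}, g i = ∑' i, {i | i ∉ F}.indicator g i from
        tsum_subtype {i | i ∉ F} g]
      refine tsum_congr fun i => ?_
      rw [hterm]
      by_cases hi : i ∈ F <;> simp [hi, hg]
    simp_rw [heq]
    have := (ENNReal.continuous_rpow_const (y := (1 / 2 : ℝ))).continuousAt.tendsto.comp
      (ENNReal.tendsto_tsum_compl_atTop_zero hgt)
    rw [ENNReal.zero_rpow_of_pos (by norm_num)] at this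
    exact this
  refine tendsto_iff_norm_sub_tendsto_zero.2 ?_
  exact (ENNReal.tendsto_toReal ENNReal.zero_ne_top).comp hlim

/-- The Carleson quotients of the coefficients of a functional are at most its norm: it suffices
to test the functional on the finite truncations of its own coefficients. -/
theorem carleson_conj_apply_single_le (L : StrongDual ℂ (S1 μ₁ μ₂ D₁ D₂))
    (Ω : Set (X₁ × X₂)) :
    carleson μ₁ μ₂ (fun i => starRingEnd ℂ (L (S1.single h₁ h₂ i))) Ω ≤ ‖L‖ₑ := by
  classical
  set t : HaarSeq D₁ D₂ := fun i => starRingEnd ℂ (L (S1.single h₁ h₂ i)) with ht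
  have hF : ∀ F : Finset (HaarIndex D₁ × HaarIndex D₂), (∀ i ∈ F, haarRect i ⊆ Ω) →
      ∑ i ∈ F, ‖t i‖ₑ ^ 2 ≤ ‖L‖ₑ ^ 2 * μ₁.prod μ₂ Ω := by
    intro F hF
    set A := ∑ i ∈ F, ‖t i‖ₑ ^ 2 with hA
    set v := ∑ i ∈ F, t i • S1.single h₁ h₂ i with hv
    have hvnorm : ‖v‖ₑ ≤ A ^ (1 / 2 : ℝ) * μ₁.prod μ₂ Ω ^ (1 / 2 : ℝ) := by
      rw [S1.enorm_eq]
      have hsupp : ∀ i, S1.toSeq μ₁ μ₂ D₁ D₂ v i = if i ∈ F then t i else 0 :=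
        S1.toSeq_sum_smul_single h₁ h₂ F t
      refine (s1Norm_le_of_support h₁ h₂ (Ω := Ω) fun i hi => ?_).trans_eq ?_
      · rw [hsupp] at hi
        exact hF i (by by_contra h; simp [h] at hi)
      · congr 2
        rw [tsum_eq_sum (s := F) fun i hi => by simp [hsupp, hi], hA]
        exact Finset.sum_congr rfl fun i hi => by simp [hsupp, hi]
    have hLv : ‖L v‖ₑ = A := by
      have hsum : L v = ((∑ i ∈ F, ‖t i‖ ^ 2 : ℝ) : ℂ) := by
        rw [hv, map_sum]
        push_cast
        refine Finset.sum_congr rfl fun i _ => ?_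
        rw [map_smul, smul_eq_mul, ← Complex.mul_conj']
        simp [ht]
      rw [hsum, ← ofReal_norm, Complex.norm_real,
        Real.norm_of_nonneg (Finset.sum_nonneg fun _ _ => by positivity),
        ENNReal.ofReal_sum_of_nonneg fun _ _ => by positivity]
      exact Finset.sum_congr rfl fun i _ => by rw [ENNReal.ofReal_pow (norm_nonneg _), ofReal_norm]
    have hAt : A ≠ ∞ := by rw [← hLv]; exact enorm_ne_top
    have hmain : A ≤ ‖L‖ₑ * (A ^ (1 / 2 : ℝ) * μ₁.prod μ₂ Ω ^ (1 / 2 : ℝ)) := by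
      rw [← hLv]
      exact (L.le_opENorm v).trans (mul_le_mul_right (hLv ▸ hvnorm) _)
    by_cases hA0 : A = 0
    · simp [hA0]
    -- Divide by the square root of `A`, then square.
    have hr0 : A ^ (1 / 2 : ℝ) ≠ 0 := by simp [hA0]
    have hrt : A ^ (1 / 2 : ℝ) ≠ ∞ := ENNReal.rpow_ne_top_of_nonneg (by norm_num) hAt
    have hdiv : A ^ (1 / 2 : ℝ) ≤ ‖L‖ₑ * μ₁.prod μ₂ Ω ^ (1 / 2 : ℝ) := by
      rw [← ENNReal.mul_le_mul_iff_right hr0 hrt, ← pow_two, sq_rpow_half]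
      exact hmain.trans_eq (by ring)
    have := pow_le_pow_left' hdiv 2
    rwa [mul_pow, sq_rpow_half, sq_rpow_half] at this
  have htsum : ∑' i : {i : HaarIndex D₁ × HaarIndex D₂ // i.1.cube ×ˢ i.2.cube ⊆ Ω}, ‖t i‖ₑ ^ 2 ≤
      ‖L‖ₑ ^ 2 * μ₁.prod μ₂ Ω := by
    rw [ENNReal.tsum_eq_iSup_sum]
    refine iSup_le fun F => ?_
    have := hF (F.map (Function.Embedding.subtype _)) fun i hi => by
      obtain ⟨j, -, rfl⟩ := Finset.mem_map.1 hi
      exact j.2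
    rwa [Finset.sum_map] at this
  rw [carleson, ← rpow_half_sq ‖L‖ₑ]
  refine ENNReal.rpow_le_rpow ?_ (by norm_num)
  calc _ ≤ (μ₁.prod μ₂ Ω)⁻¹ * (‖L‖ₑ ^ 2 * μ₁.prod μ₂ Ω) := mul_le_mul_right htsum _
    _ = ‖L‖ₑ ^ 2 * (μ₁.prod μ₂ Ω * (μ₁.prod μ₂ Ω)⁻¹) := by ring
    _ ≤ ‖L‖ₑ ^ 2 := mul_le_of_le_one_right' (ENNReal.mul_inv_le_one _)

theorem c1Norm_conj_apply_single_le (L : StrongDual ℂ (S1 μ₁ μ₂ D₁ D₂)) :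
    c1Norm μ₁ μ₂ (fun i => starRingEnd ℂ (L (S1.single h₁ h₂ i))) ≤ ‖L‖ₑ :=
  iSup_le fun Ω => iSup_le fun _ => iSup_le fun _ => carleson_conj_apply_single_le h₁ h₂ L Ω

include h₁ h₂ in
theorem tsum_norm_mul_conj_le (t : C1 μ₁ μ₂ D₁ D₂) (s : S1 μ₁ μ₂ D₁ D₂) :
    Summable (fun i => ‖s i * (starRingEnd ℂ) (t i)‖) ∧
      ∑' i, ‖s i * (starRingEnd ℂ) (t i)‖ ≤ 8 * ‖t‖ * ‖s‖ := by
  have hle := tsum_enorm_mul_le h₁ h₂ (s := s.1) (t := t.1) s.2.ne t.2.ne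
  have hR : 8 * c1Norm μ₁ μ₂ t.1 * s1Norm μ₁ μ₂ s.1 ≠ ∞ :=
    ENNReal.mul_ne_top (ENNReal.mul_ne_top (by norm_num) t.2.ne) s.2.ne
  have heq : ∀ i, ‖s i * (starRingEnd ℂ) (t i)‖ = (‖s.1 i‖ₑ * ‖t.1 i‖ₑ).toReal := fun i => by
    simp
  simp_rw [heq]
  have hsum := ne_top_of_le_ne_top hR hle
  refine ⟨ENNReal.summable_toReal hsum, ?_⟩
  rw [← ENNReal.tsum_toReal_eq fun i => ENNReal.ne_top_of_tsum_ne_top hsum i]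
  refine (ENNReal.toReal_mono hR hle).trans_eq ?_
  rw [ENNReal.toReal_mul, ENNReal.toReal_mul]
  rfl

/-- The functional `s ↦ ∑ s i * conj (t i)` on `s¹`. -/
noncomputable def pairing (t : C1 μ₁ μ₂ D₁ D₂) : StrongDual ℂ (S1 μ₁ μ₂ D₁ D₂) :=
  LinearMap.mkContinuous
    { toFun := fun s => ∑' i, s i * (starRingEnd ℂ) (t i)
      map_add' := fun s s' => by
        rw [← (tsum_norm_mul_conj_le h₁ h₂ t s).1.of_norm.tsum_add
          (tsum_norm_mul_conj_le h₁ h₂ t s').1.of_norm]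
        exact tsum_congr fun i => add_mul _ _ _
      map_smul' := fun c s => by
        rw [RingHom.id_apply, smul_eq_mul, ← tsum_mul_left]
        exact tsum_congr fun i => mul_assoc _ _ _ }
    (8 * ‖t‖) fun s => (norm_tsum_le_tsum_norm (tsum_norm_mul_conj_le h₁ h₂ t s).1).trans
      (tsum_norm_mul_conj_le h₁ h₂ t s).2

theorem hasSum_pairing (t : C1 μ₁ μ₂ D₁ D₂) (s : S1 μ₁ μ₂ D₁ D₂) :
    HasSum (fun i => s i * (starRingEnd ℂ) (t i)) (pairing h₁ h₂ t s) :=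
  (tsum_norm_mul_conj_le h₁ h₂ t s).1.of_norm.hasSum

theorem norm_pairing_le (t : C1 μ₁ μ₂ D₁ D₂) : ‖pairing h₁ h₂ t‖ ≤ 8 * ‖t‖ :=
  LinearMap.mkContinuous_norm_le _ (mul_nonneg (by norm_num) ENNReal.toReal_nonneg) _

theorem conj_pairing_single (t : C1 μ₁ μ₂ D₁ D₂) (i : HaarIndex D₁ × HaarIndex D₂) :
    starRingEnd ℂ (pairing h₁ h₂ t (S1.single h₁ h₂ i)) = t i := by
  classical
  have hs : ∀ j, (S1.single h₁ h₂ i) j = (Pi.single i 1 : HaarSeq D₁ D₂) j := fun j => by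
    simp only [S1.single]
  rw [(hasSum_pairing h₁ h₂ t _).unique (hasSum_single i fun j hj => by
    rw [hs, Pi.single_eq_of_ne hj, zero_mul]), hs]
  simp

theorem norm_le_norm_pairing (t : C1 μ₁ μ₂ D₁ D₂) : ‖t‖ ≤ ‖pairing h₁ h₂ t‖ := by
  have h := c1Norm_conj_apply_single_le h₁ h₂ (pairing h₁ h₂ t)
  simp_rw [conj_pairing_single] at h
  rw [← toReal_enorm (pairing h₁ h₂ t)]
  exact ENNReal.toReal_mono enorm_ne_top h

/-- A functional is the pairing with its coefficients, since finite sequences are dense. -/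
theorem exists_pairing_eq (L : StrongDual ℂ (S1 μ₁ μ₂ D₁ D₂)) :
    ∃ t : C1 μ₁ μ₂ D₁ D₂, pairing h₁ h₂ t = L := by
  refine ⟨⟨fun i => starRingEnd ℂ (L (S1.single h₁ h₂ i)),
    (c1Norm_conj_apply_single_le h₁ h₂ L).trans_lt enorm_lt_top⟩, ?_⟩
  ext s
  refine (hasSum_pairing h₁ h₂ _ s).unique ?_
  have := (S1.hasSum_smul_single h₁ h₂ s).mapL L
  simpa using this

variable (D₁ D₂) in
/-- The conjugate-linear map `t ↦ (s ↦ ∑ s i * conj (t i))` from `c¹` to the dual of `s¹`. -/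
noncomputable def pairingMap : C1 μ₁ μ₂ D₁ D₂ →ₛₗ[starRingEnd ℂ] StrongDual ℂ (S1 μ₁ μ₂ D₁ D₂) where
  toFun := pairing h₁ h₂
  map_add' t t' := by
    ext s
    refine (hasSum_pairing h₁ h₂ _ s).unique ?_
    have h : (fun i => s i * (starRingEnd ℂ) ((t + t') i)) =
        fun i => s i * (starRingEnd ℂ) (t i) + s i * (starRingEnd ℂ) (t' i) := funext fun i => by
      change s i * (starRingEnd ℂ) (t i + t' i) = _
      rw [map_add, mul_add]
    rw [h]
    exact (hasSum_pairing h₁ h₂ t s).add (hasSum_pairing h₁ h₂ t' s)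
  map_smul' c t := by
    ext s
    refine (hasSum_pairing h₁ h₂ _ s).unique ?_
    have h : (fun i => s i * (starRingEnd ℂ) ((c • t) i)) =
        fun i => starRingEnd ℂ c * (s i * (starRingEnd ℂ) (t i)) := funext fun i => by
      change s i * (starRingEnd ℂ) (c * t i) = _
      rw [map_mul, mul_left_comm]
    rw [h]
    exact (hasSum_pairing h₁ h₂ t s).mul_left (starRingEnd ℂ c)

theorem pairingMap_bijective : Function.Bijective (pairingMap D₁ D₂ h₁ h₂) := by
  refine ⟨fun t t' h => ?_, exists_pairing_eq h₁ h₂⟩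
  refine Subtype.ext (funext fun i => ?_)
  have h' : pairing h₁ h₂ t = pairing h₁ h₂ t' := h
  have := conj_pairing_single h₁ h₂ t i
  rw [h', conj_pairing_single] at this
  exact this.symm

end Dual

end ProductHaar

theorem mainTheorem8 {X₁ X₂ : Type*}
    [TopologicalSpace X₁] [MeasurableSpace X₁] [TopologicalSpace X₂] [MeasurableSpace X₂]
    (ρ₁ : X₁ → X₁ → ℝ) (ρ₂ : X₂ → X₂ → ℝ) (μ₁ : Measure X₁) (μ₂ : Measure X₂)
    (h₁ : IsHomogeneousType ρ₁ μ₁) (h₂ : IsHomogeneousType ρ₂ μ₂)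
    (D₁ : DyadicSystem ρ₁) (D₂ : DyadicSystem ρ₂) :
    ∃ (Φ : C1 μ₁ μ₂ D₁ D₂ ≃ₛₗ[starRingEnd ℂ] StrongDual ℂ (S1 μ₁ μ₂ D₁ D₂)) (C : ℝ),
      (∀ (t : C1 μ₁ μ₂ D₁ D₂) (s : S1 μ₁ μ₂ D₁ D₂),
        HasSum (fun i => s i * (starRingEnd ℂ) (t i)) (Φ t s)) ∧
      ∀ t : C1 μ₁ μ₂ D₁ D₂, ‖t‖ ≤ ‖Φ t‖ ∧ ‖Φ t‖ ≤ C * ‖t‖ :=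
  ⟨LinearEquiv.ofBijective (pairingMap D₁ D₂ h₁ h₂) (pairingMap_bijective h₁ h₂), 8,
    hasSum_pairing h₁ h₂, fun t => ⟨norm_le_norm_pairing h₁ h₂ t, norm_pairing_le h₁ h₂ t⟩⟩
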